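/- \textbf{Problem.} Let $\Phi_h(x)=f(x)+h(c(x))$ for $x\in\mathbb R^n$, where $f:\mathbb R^n\to\mathbb R$ and $c:\mathbb R^n\to\mathbb R^q$ are continuously differentiable, $f$ is bounded below, $\nabla f$ and the Jacobian $J$ of $c$ are Lipschitz continuous with constants $L_g$ and $L_J$ (Euclidean norm for vectors, operator norm for matrices), $h:\mathbb R^q\to\mathbb R$ is convex and Lipschitz continuous with constant $L_h$, and $\Phi_h(x)\ge\Phi_h^{low}$ for all $x$. Put $L=L_g+L_hL_J$. For $\gamma>0$ and $x,g\in\mathbb R^n$ let $$x^+=\operatorname*{argmin}_{u\in\mathbb R^n}\Big\{\langle g,u-x\rangle+h\big(c(x)+J(x)(u-x)\big)+\tfrac1{2\gamma}\|u-x\|^2\Big\},\qquad P_\gamma(x,g)=\tfrac1\gamma(x-x^+).$$ \textbf{Algorithm.} Let $x_1\in\mathbb R^n$, $N\ge1$, $\mu>0$, stepsizes $\gamma_k>0$ and integer batch sizes $m_k\ge1$ ($1\le k\le N$) be given. Let $\xi_{k,i}$ be random elements of a measurable space $\Xi$, $v_{k,i}$ standard Gaussian vectors in $\mathbb R^n$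 ($1\le k\le N$, $1\le i\le m_k$), and $R$ a random variable, all mutually independent. With $$G_\mu(x,\xi,v)=\frac{F(x+\mu v,\xi)-F(x,\xi)}{\mu}\,v,\qquad G_{\mu,k}=\frac1{m_k}\sum_{i=1}^{m_k}G_\mu(x_k,\xi_{k,i},v_{k,i}),$$ the iterates are $x_{k+1}=x_k-\gamma_kP_{\gamma_k}(x_k,G_{\mu,k})$, that is, $x_{k+1}$ is the point $x^+$ for $x=x_k$, $g=G_{\mu,k}$, $\gamma=\gamma_k$. Let $\tilde g^r_{\mu,k}=P_{\gamma_k}(x_k,G_{\mu,k})$. \textbf{Oracle.} For every $x$ the function $F(x,\cdot)$ is measurable; for every $\xi\in\Xi$ the function $F(\cdot,\xi)$ is continuously differentiable and $G(\cdot,\xi):=\nabla_xF(\cdot,\xi)$ is Lipschitz continuous with constant $L_g$. For all $k,i$: $\mathbb E[F(x,\xi_{k,i})]=f(x)$ and $\mathbb E[G(x,\xi_{k,i})]=\nabla f(x)$ for every $x\in\mathbb R^n$, and $\mathbb E\big[\|G(x_k,\xi_{k,i})-\nabla f(x_k)\|^2\big]\le\sigma^2$, where $\sigma>0$ (all these expectations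 exist). \textbf{Theorem.} Suppose that $0<\gamma_k\le 2/L$ for $k=1,\dots,N$, with $\gamma_k<2/L$ for at least one $k$ (where $2/L=\infty$ if $L=0$), that $$\mathrm{Prob}\{R=k\}=\frac{\gamma_k-L\gamma_k^2/2}{\sum_{j=1}^N(\gamma_j-L\gamma_j^2/2)},\qquad k=1,\dots,N,$$ and that there is $\kappa_g>0$ such that, almost surely, $\|\nabla f(x_k)\|\le\kappa_g$ for all $k=1,\dots,N$. Then $\|\tilde g^r_{\mu,R}\|^2$ is integrable and $$\mathbb E\big[\|\tilde g^r_{\mu,R}\|^2\big]\le\frac{D_{\Phi_h}+\mu^2L_gn+\tilde\sigma^2\sum_{k=1}^N(\gamma_k/m_k)}{\sum_{k=1}^N(\gamma_k-L\gamma_k^2/2)},$$ where the expectation is over $R$ and all $\xi_{k,i}$, $v_{k,i}$, and $D_{\Phi_h}=\Phi_h(x_1)-\Phi_h^{low}$, $\tilde\sigma^2=2(n+4)\big[\kappa_g^2+\sigma^2+\mu^2L_g^2(n+4)^2\big]$. -/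

import Mathlib

open MeasureTheory ProbabilityTheory Set
open scoped NNReal

noncomputable section

/-- The Euclidean space of dimension `d`. -/
abbrev Euc (d : ℕ) : Type := EuclideanSpace ℝ (Fin d)

namespace StochNCO

variable {n q : ℕ} {Ξ : Type*}

/-- The composite objective `Φ_h x = f x + h (c x)`. -/
def Phi (f : Euc n → ℝ) (h : Euc q → ℝ) (c : Euc n → Euc q) (x : Euc n) : ℝ :=
  f x + h (c x)

/-- The model function
`ψ_γ (x, g, u) = ⟨g, u - x⟩ + h (c x + J x (u - x)) + ‖u - x‖² / (2 γ)`,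
where `J x` is the Jacobian (Fréchet derivative) of `c` at `x`. -/
def psi (h : Euc q → ℝ) (c : Euc n → Euc q) (γ : ℝ) (x g u : Euc n) : ℝ :=
  inner ℝ g (u - x) + h (c x + fderiv ℝ c x (u - x)) + 1 / (2 * γ) * ‖u - x‖ ^ 2

/-- The point `x⁺ = argmin_u ψ_γ (x, g, u)`. For `h` convex and Lipschitz and `γ > 0` the function
`u ↦ ψ_γ (x, g, u)` is continuous and strongly convex, so that it has exactly one minimizer,
and `xPlus` is this minimizer. -/
def xPlus (h : Euc q → ℝ) (c : Euc n → Euc q) (γ : ℝ) (x g : Euc n) : Euc n :=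
  Classical.epsilon fun y => IsMinOn (psi h c γ x g) univ y

/-- The generalized gradient `P_γ (x, g) = (x - x⁺) / γ`. -/
def genGrad (h : Euc q → ℝ) (c : Euc n → Euc q) (γ : ℝ) (x g : Euc n) : Euc n :=
  (1 / γ) • (x - xPlus h c γ x g)

/-- The stochastic gradient `G (x, ξ) = ∇_x F (x, ξ)`. -/
def stochGrad (F : Euc n → Ξ → ℝ) (x : Euc n) (s : Ξ) : Euc n :=
  gradient (fun y => F y s) x

/-- The zeroth-order gradient estimate `G_μ (x, ξ, v) = ((F (x + μ v, ξ) - F (x, ξ)) / μ) v`. -/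
def zoGrad (F : Euc n → Ξ → ℝ) (μ : ℝ) (x : Euc n) (s : Ξ) (v : Euc n) : Euc n :=
  ((F (x + μ • v) s - F x s) / μ) • v

/-- The average `(1 / m) ∑_i G_μ (x, ξ_i, v_i)` over a batch of `m` samples, indexed by
`i = 0, …, m - 1`. -/
def batchGrad (F : Euc n → Ξ → ℝ) (μ : ℝ) (m : ℕ) (x : Euc n) (s : ℕ → Ξ) (v : ℕ → Euc n) :
    Euc n :=
  (1 / (m : ℝ)) • ∑ i ∈ Finset.range m, zoGrad F μ x (s i) (v i)

/-- The iterates `x_1, x_2, …` of the stochastic zeroth-order algorithm, for given samples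
`s k i`, `v k i`: `x_1` is the starting point and `x_{k+1} = argmin_u ψ_{γ_k} (x_k, G_{μ,k}, u)`
for `k ≥ 1`, where `G_{μ,k}` is the average over the batch `s k i`, `v k i`, `i < m_k`.
The iterates are numbered from `1`; the value at the unused index `0` is irrelevant. -/
def iterate (h : Euc q → ℝ) (c : Euc n → Euc q) (F : Euc n → Ξ → ℝ) (μ : ℝ) (γ : ℕ → ℝ)
    (m : ℕ → ℕ) (x₁ : Euc n) (s : ℕ → ℕ → Ξ) (v : ℕ → ℕ → Euc n) : ℕ → Euc n
  | 0 => x₁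
  | 1 => x₁
  | k + 2 =>
      let x := iterate h c F μ γ m x₁ s v (k + 1)
      xPlus h c (γ (k + 1)) x (batchGrad F μ (m (k + 1)) x (s (k + 1)) (v (k + 1)))

/-- The stochastic generalized gradient `g̃^r_{μ,k} = P_{γ_k} (x_k, G_{μ,k})`. -/
def stochGenGrad (h : Euc q → ℝ) (c : Euc n → Euc q) (F : Euc n → Ξ → ℝ) (μ : ℝ) (γ : ℕ → ℝ)
    (m : ℕ → ℕ) (x₁ : Euc n) (s : ℕ → ℕ → Ξ) (v : ℕ → ℕ → Euc n) (k : ℕ) : Euc n :=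
  let x := iterate h c F μ γ m x₁ s v k
  genGrad h c (γ k) x (batchGrad F μ (m k) x (s k) (v k))

/-- The indices `(k, i)`, `1 ≤ k ≤ N`, `i < m_k`, of the samples. -/
abbrev SampleIdx (N : ℕ) (m : ℕ → ℕ) : Type :=
  Σ k : Finset.Icc 1 N, Fin (m k)

end StochNCO

end

/-! The estimator `G_μ` is biased for `∇f`, but by Stein's identity it is unbiased for `∇f_μ`, where
`f_μ(x) = 𝔼 f(x + μ v)` is the Gaussian smoothing (`integral_gaussDiff`). The proof therefore
analyses a stochastic prox-linear method for `f_μ + h ∘ c`. The smoothing keeps the quadratic upper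
bound with constant `Lg` (`gaussSmooth_le`) and differs from `f` by at most `μ² Lg n / 2`
(`abs_gaussSmooth_sub_le`); paying this at the first and at the last point gives the term `μ² Lg n`.

For one step write `p = P_γ(x, g)`, `a = ∇f_μ(x)`, `δ = g - a`. Testing the optimality of `x⁺`
against `x` yields a model decrease of `γ ‖p‖²`; linearizing `f_μ` and `c` costs `L γ² ‖p‖² / 2`,
and the inexact gradient costs `γ ⟨δ, p⟩`. Here `p` depends on the batch, so it is replaced by `b =
P_γ(x, a)`, which does not; as `P_γ(x, ·)` is nonexpansive, the replacement costs at most `γ ‖δ‖²`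
(`descent_step`).

Given the past, `⟨δ, b⟩` has mean zero. The noises within a batch are centred and mutually
orthogonal, and Gaussian moments up to order six bound each second moment by `σ̃²`; hence `𝔼 ‖δ‖² ≤
σ̃² / m` (`BatchSetup.integral_noise_le`). Telescoping bounds `∑ (γ_k - L γ_k² / 2) 𝔼 ‖g̃_k‖²`, and
the law of `R` is proportional to exactly these weights (`integral_random_index`). -/

/-! ### Quadratic Taylor bounds for functions with Lipschitz derivative. -/

theorem norm_sub_sub_fderiv_le {E G : Type*} [NormedAddCommGroup E] [NormedSpace ℝ E]
    [NormedAddCommGroup G] [NormedSpace ℝ G] {φ : E → G} {K : ℝ≥0}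
    (hφ : Differentiable ℝ φ) (hK : LipschitzWith K (fderiv ℝ φ)) (x y : E) :
    ‖φ y - φ x - fderiv ℝ φ x (y - x)‖ ≤ K / 2 * ‖y - x‖ ^ 2 := by
  set d := y - x with hd
  let r : ℝ → G := fun t => φ (x + t • d) - φ x - t • fderiv ℝ φ x d
  have hr : ∀ t, HasDerivAt r (fderiv ℝ φ (x + t • d) d - fderiv ℝ φ x d) t := by
    intro t
    have h1 : HasDerivAt (fun t : ℝ => x + t • d) d t := by
      simpa using ((hasDerivAt_id t).smul_const d).const_add x
    have h2 : HasDerivAt (fun t : ℝ => φ (x + t • d)) (fderiv ℝ φ (x + t • d) d) t :=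
      (hφ (x + t • d)).hasFDerivAt.comp_hasDerivAt t h1
    have h3 : HasDerivAt (fun t : ℝ => t • fderiv ℝ φ x d) (fderiv ℝ φ x d) t := by
      simpa using (hasDerivAt_id t).smul_const (fderiv ℝ φ x d)
    exact (h2.sub_const _).sub h3
  have hB : ∀ t : ℝ, HasDerivAt (fun t : ℝ => K / 2 * ‖d‖ ^ 2 * t ^ 2) (K * ‖d‖ ^ 2 * t) t := by
    intro t
    convert! (hasDerivAt_pow 2 t).const_mul ((K : ℝ) / 2 * ‖d‖ ^ 2) using 1
    push_cast; ring
  -- The remainder along the segment starts at zero and has speed at most `K ‖d‖² t`, the derivative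
  -- of the comparison function `K / 2 ‖d‖² t²`.
  have key := image_norm_le_of_norm_deriv_right_le_deriv_boundary (a := 0) (b := 1) (f := r)
    (f' := fun t => fderiv ℝ φ (x + t • d) d - fderiv ℝ φ x d)
    (fun t _ => (hr t).continuousAt.continuousWithinAt) (fun t _ => (hr t).hasDerivWithinAt)
    (B := fun t : ℝ => K / 2 * ‖d‖ ^ 2 * t ^ 2) (B' := fun t => K * ‖d‖ ^ 2 * t)
    (by simp [r]) hB (by
      intro t ht
      rw [← sub_apply]
      refine (ContinuousLinearMap.le_opNorm _ _).trans ?_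
      have h4 := hK.norm_sub_le (x + t • d) x
      rw [add_sub_cancel_left, norm_smul, Real.norm_of_nonneg ht.1] at h4
      calc _ ≤ K * (t * ‖d‖) * ‖d‖ := by gcongr
        _ = _ := by ring) (x := 1) (by simp)
  simpa [r, hd] using key

section Gradient

variable {E : Type*} [NormedAddCommGroup E] [InnerProductSpace ℝ E] [CompleteSpace E]

theorem fderiv_eq_inner_gradient (f : E → ℝ) (x d : E) :
    fderiv ℝ f x d = inner ℝ (gradient f x) d := by
  simp [gradient]

theorem LipschitzWith.fderiv_of_gradient {f : E → ℝ} {K : ℝ≥0}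
    (hK : LipschitzWith K (gradient f)) : LipschitzWith K (fderiv ℝ f) := by
  have h := (InnerProductSpace.toDual ℝ E).isometry.lipschitz.comp hK
  rw [one_mul] at h
  convert! h using 1
  ext x d
  simp [gradient]

theorem abs_sub_sub_inner_gradient_le {f : E → ℝ} {K : ℝ≥0} (hf : Differentiable ℝ f)
    (hK : LipschitzWith K (gradient f)) (x y : E) :
    |f y - f x - inner ℝ (gradient f x) (y - x)| ≤ K / 2 * ‖y - x‖ ^ 2 := by
  rw [← fderiv_eq_inner_gradient, ← Real.norm_eq_abs]
  exact norm_sub_sub_fderiv_le hf hK.fderiv_of_gradient x y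

end Gradient

/-! ### The prox-linear step: optimality, stability and descent. -/

namespace StochNCO

variable {n q : ℕ} {h : Euc q → ℝ} {c : Euc n → Euc q} {γ : ℝ} {Lh LJ : ℝ≥0}

/-- Compare `y` with `y + t (u - y)`: convexity handles `h`, the quadratic is expanded exactly, and
dividing by `t` leaves `0 ≤ Q + t K`. Small `t` then forces `0 ≤ Q`. -/
theorem variational_of_isMinOn_psi (hconv : ConvexOn ℝ univ h) (hγ : 0 < γ) {x g y : Euc n}
    (hy : IsMinOn (psi h c γ x g) univ y) (u : Euc n) :
    inner ℝ g (y - x) + h (c x + fderiv ℝ c x (y - x)) + 1 / γ * inner ℝ (x - y) (u - y) ≤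
      inner ℝ g (u - x) + h (c x + fderiv ℝ c x (u - x)) := by
  set Q := inner ℝ g (u - x) + h (c x + fderiv ℝ c x (u - x)) - (inner ℝ g (y - x) +
    h (c x + fderiv ℝ c x (y - x)) + 1 / γ * inner ℝ (x - y) (u - y)) with hQ
  set K := 1 / (2 * γ) * ‖u - y‖ ^ 2 with hK
  have hK0 : 0 ≤ K := by positivity
  have key : ∀ t : ℝ, 0 < t → t ≤ 1 → 0 ≤ Q + t * K := by
    intro t ht ht1
    have h1 : psi h c γ x g y ≤ psi h c γ x g (y + t • (u - y)) := hy (mem_univ _)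
    have h2 := hconv.2 (mem_univ (c x + fderiv ℝ c x (y - x)))
      (mem_univ (c x + fderiv ℝ c x (u - x))) (sub_nonneg.2 ht1) ht.le (by ring)
    have h3 : (1 - t) • (c x + fderiv ℝ c x (y - x)) + t • (c x + fderiv ℝ c x (u - x)) =
        c x + fderiv ℝ c x (y + t • (u - y) - x) := by
      simp only [map_sub, map_add, map_smul]
      module
    have h4 : ‖y + t • (u - y) - x‖ ^ 2 =
        ‖y - x‖ ^ 2 - 2 * t * inner ℝ (x - y) (u - y) + t ^ 2 * ‖u - y‖ ^ 2 := by
      have : y + t • (u - y) - x = t • (u - y) - (x - y) := by module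
      rw [this, norm_sub_sq_real, norm_smul, inner_smul_left, real_inner_comm, mul_pow,
        norm_sub_rev y x]
      simp
      ring
    have h5 : inner ℝ g (y + t • (u - y) - x) =
        (1 - t) * inner ℝ g (y - x) + t * inner ℝ g (u - x) := by
      have : y + t • (u - y) - x = (1 - t) • (y - x) + t • (u - x) := by module
      rw [this, inner_add_right, inner_smul_right, inner_smul_right]
    rw [h3] at h2
    simp only [psi, h4, h5, smul_eq_mul] at h1 h2
    have h6 : 0 ≤ t * (Q + t * K) := by
      have : 1 / (2 * γ) * (‖y - x‖ ^ 2 - 2 * t * inner ℝ (x - y) (u - y) +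
          t ^ 2 * ‖u - y‖ ^ 2) = 1 / (2 * γ) * ‖y - x‖ ^ 2 -
            t * (1 / γ * inner ℝ (x - y) (u - y)) + t * (t * K) := by
        rw [hK]; field_simp
      rw [this] at h1
      rw [hQ]
      linarith
    exact nonneg_of_mul_nonneg_right h6 ht
  by_contra! hlt
  have hQneg : Q < 0 := by rw [hQ]; linarith
  -- If `Q < 0`, this `t` lies in `(0, 1]` and satisfies `t K < -Q`, which replaces the limit `t →
  -- 0`.
  have h7 := key (-Q / (K - Q)) (by apply div_pos <;> linarith)
    (by rw [div_le_one (by linarith)]; linarith)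
  have h8 : -Q / (K - Q) * K < -Q := by
    rw [div_mul_eq_mul_div, div_lt_iff₀ (by linarith)]
    nlinarith
  linarith

theorem exists_isMinOn_psi (hhLip : LipschitzWith Lh h) (hγ : 0 < γ) (x g : Euc n) :
    ∃ y, IsMinOn (psi h c γ x g) univ y := by
  have hcont : Continuous (psi h c γ x g) := by
    have := hhLip.continuous
    unfold psi
    fun_prop
  -- Beyond this distance from `x` the proximal term outweighs the largest possible linear gain of
  -- the other two terms, so `psi` is at least its value at `x`.
  set B := 2 * γ * (‖g‖ + Lh * ‖fderiv ℝ c x‖) with hB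
  obtain ⟨y, hy⟩ := hcont.exists_forall_le' x (by
    filter_upwards [(isCompact_closedBall x B).compl_mem_cocompact] with u hu
    have hr : B < ‖u - x‖ := by simpa [dist_eq_norm] using hu
    have h1 : -(‖g‖ * ‖u - x‖) ≤ inner ℝ g (u - x) :=
      (abs_le.1 (abs_real_inner_le_norm g (u - x))).1
    have h2 : h (c x) - h (c x + fderiv ℝ c x (u - x)) ≤ Lh * (‖fderiv ℝ c x‖ * ‖u - x‖) := by
      refine (le_abs_self _).trans ?_
      rw [← Real.norm_eq_abs]
      refine (hhLip.norm_sub_le _ _).trans ?_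
      gcongr
      rw [sub_add_cancel_left, norm_neg]
      exact ContinuousLinearMap.le_opNorm _ _
    have h3 : (‖g‖ + Lh * ‖fderiv ℝ c x‖) * ‖u - x‖ ≤ 1 / (2 * γ) * ‖u - x‖ ^ 2 := by
      have : ‖g‖ + Lh * ‖fderiv ℝ c x‖ = 1 / (2 * γ) * B := by rw [hB]; field_simp
      rw [this, pow_two, mul_assoc]
      gcongr
    simp only [psi, sub_self, inner_zero_right, map_zero, add_zero, norm_zero]
    ring_nf at h1 h2 h3 ⊢
    linarith)
  exact ⟨y, fun u _ => hy u⟩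

/-- All later facts about `xPlus` come from minimality alone, so the choice made by
`Classical.epsilon` plays no role. -/
theorem isMinOn_xPlus (hhLip : LipschitzWith Lh h) (hγ : 0 < γ) (x g : Euc n) :
    IsMinOn (psi h c γ x g) univ (xPlus h c γ x g) :=
  Classical.epsilon_spec (exists_isMinOn_psi hhLip hγ x g)

theorem xPlus_sub (hγ : 0 < γ) (x g : Euc n) : xPlus h c γ x g - x = -(γ • genGrad h c γ x g) := by
  rw [genGrad, smul_smul, mul_one_div_cancel hγ.ne', one_smul]
  abel

theorem xPlus_variational (hconv : ConvexOn ℝ univ h) (hhLip : LipschitzWith Lh h) (hγ : 0 < γ)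
    (x g u : Euc n) :
    inner ℝ g (xPlus h c γ x g - x) + h (c x + fderiv ℝ c x (xPlus h c γ x g - x)) +
        inner ℝ (genGrad h c γ x g) (u - xPlus h c γ x g) ≤
      inner ℝ g (u - x) + h (c x + fderiv ℝ c x (u - x)) := by
  have := variational_of_isMinOn_psi hconv hγ (isMinOn_xPlus (c := c) hhLip hγ x g) u
  rwa [genGrad, inner_smul_left]

/-- This is the variational inequality tested at `u = x`. -/
theorem model_decrease (hconv : ConvexOn ℝ univ h) (hhLip : LipschitzWith Lh h) (hγ : 0 < γ)
    (x g : Euc n) :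
    h (c x + fderiv ℝ c x (xPlus h c γ x g - x)) ≤
      h (c x) + γ * inner ℝ g (genGrad h c γ x g) - γ * ‖genGrad h c γ x g‖ ^ 2 := by
  have h1 := xPlus_variational (c := c) hconv hhLip hγ x g x
  have h2 : inner ℝ (genGrad h c γ x g) (x - xPlus h c γ x g) = γ * ‖genGrad h c γ x g‖ ^ 2 := by
    rw [← neg_sub, xPlus_sub hγ, neg_neg, inner_smul_right, real_inner_self_eq_norm_sq]
  have h3 : inner ℝ g (xPlus h c γ x g - x) = -(γ * inner ℝ g (genGrad h c γ x g)) := by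
    rw [xPlus_sub hγ, inner_neg_right, inner_smul_right]
  rw [h2, h3] at h1
  rw [sub_self, map_zero, inner_zero_right, add_zero, zero_add] at h1
  linarith

/-- Test each variational inequality at the other minimizer and add: the `h` terms cancel, and what
remains is `‖p₁ - p₂‖² ≤ ⟨g₁ - g₂, p₁ - p₂⟩`. -/
theorem norm_genGrad_sub_le (hconv : ConvexOn ℝ univ h) (hhLip : LipschitzWith Lh h) (hγ : 0 < γ)
    (x g₁ g₂ : Euc n) :
    ‖genGrad h c γ x g₁ - genGrad h c γ x g₂‖ ≤ ‖g₁ - g₂‖ := by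
  have h1 := xPlus_variational (c := c) hconv hhLip hγ x g₁ (xPlus h c γ x g₂)
  have h2 := xPlus_variational (c := c) hconv hhLip hγ x g₂ (xPlus h c γ x g₁)
  have e1 := xPlus_sub (h := h) (c := c) hγ x g₁
  have e2 := xPlus_sub (h := h) (c := c) hγ x g₂
  set p₁ := genGrad h c γ x g₁
  set p₂ := genGrad h c γ x g₂
  have e3 : xPlus h c γ x g₂ - xPlus h c γ x g₁ = γ • (p₁ - p₂) := by
    rw [← sub_sub_sub_cancel_right _ _ x, e1, e2]; module
  have e4 : xPlus h c γ x g₁ - xPlus h c γ x g₂ = -(γ • (p₁ - p₂)) := by rw [← e3]; abel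
  rw [e3, e1, e2] at h1
  rw [e4, e1, e2] at h2
  have h3 : γ * ‖p₁ - p₂‖ ^ 2 ≤ γ * inner ℝ (g₁ - g₂) (p₁ - p₂) := by
    rw [← real_inner_self_eq_norm_sq]
    simp only [inner_neg_right, inner_smul_right, inner_sub_left, inner_sub_right] at *
    linarith
  have h4 := (le_of_mul_le_mul_left h3 hγ).trans (real_inner_le_norm _ _)
  by_contra! hlt
  nlinarith [norm_nonneg (g₁ - g₂)]

/-- An a priori bound, free of `γ`, that serves continuity and square integrability; it does not
enter the final constants. -/
theorem norm_genGrad_le (hconv : ConvexOn ℝ univ h) (hhLip : LipschitzWith Lh h) (hγ : 0 < γ)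
    (x g : Euc n) : ‖genGrad h c γ x g‖ ≤ ‖g‖ + Lh * ‖fderiv ℝ c x‖ := by
  have h1 := model_decrease (c := c) hconv hhLip hγ x g
  have e := xPlus_sub (h := h) (c := c) hγ x g
  set p := genGrad h c γ x g
  have h2 : h (c x) - h (c x + fderiv ℝ c x (xPlus h c γ x g - x)) ≤
      Lh * (‖fderiv ℝ c x‖ * (γ * ‖p‖)) := by
    refine (le_abs_self _).trans ?_
    rw [← Real.norm_eq_abs]
    refine (hhLip.norm_sub_le _ _).trans ?_
    gcongr
    rw [sub_add_cancel_left, norm_neg, e]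
    refine (ContinuousLinearMap.le_opNorm _ _).trans ?_
    rw [norm_neg, norm_smul, Real.norm_of_nonneg hγ.le]
  have h3 := mul_le_mul_of_nonneg_left (real_inner_le_norm g p) hγ.le
  have h4 : γ * (‖p‖ * ‖p‖) ≤ γ * ((‖g‖ + Lh * ‖fderiv ℝ c x‖) * ‖p‖) := by
    ring_nf at h1 h2 h3 ⊢
    linarith
  by_contra! hlt
  have hp : 0 < ‖p‖ := lt_of_le_of_lt (by positivity) hlt
  exact absurd (le_of_mul_le_mul_right (le_of_mul_le_mul_left h4 hγ) hp) hlt.not_ge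

/-- Stability of the prox-linear step under perturbations of the base point and the gradient. -/
theorem norm_xPlus_sub_sub_sq_le (hconv : ConvexOn ℝ univ h) (hhLip : LipschitzWith Lh h)
    (hγ : 0 < γ) (x₁ g₁ x₂ g₂ : Euc n) :
    ‖(xPlus h c γ x₁ g₁ - x₁) - (xPlus h c γ x₂ g₂ - x₂)‖ ^ 2 ≤
      γ * ((‖g₁ - g₂‖ + Lh * ‖fderiv ℝ c x₁ - fderiv ℝ c x₂‖) *
        (‖xPlus h c γ x₁ g₁ - x₁‖ + ‖xPlus h c γ x₂ g₂ - x₂‖) + 2 * Lh * ‖c x₁ - c x₂‖) := by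
  set d₁ := xPlus h c γ x₁ g₁ - x₁ with hd₁
  set d₂ := xPlus h c γ x₂ g₂ - x₂ with hd₂
  -- The displacements, not the minimizers, are exchanged. The two models are then compared at a
  -- common displacement, where they differ only through `c` and its derivative.
  have h1 := xPlus_variational (c := c) hconv hhLip hγ x₁ g₁ (x₁ + d₂)
  have h2 := xPlus_variational (c := c) hconv hhLip hγ x₂ g₂ (x₂ + d₁)
  rw [← hd₁, add_sub_cancel_left, add_sub_right_comm, ← neg_sub _ x₁, ← hd₁, neg_add_eq_sub] at h1
  rw [← hd₂, add_sub_cancel_left, add_sub_right_comm, ← neg_sub _ x₂, ← hd₂, neg_add_eq_sub] at h2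
  have e1 : γ • genGrad h c γ x₁ g₁ = -d₁ := by rw [hd₁, xPlus_sub hγ, neg_neg]
  have e2 : γ • genGrad h c γ x₂ g₂ = -d₂ := by rw [hd₂, xPlus_sub hγ, neg_neg]
  have h3 : ∀ d, |h (c x₁ + fderiv ℝ c x₁ d) - h (c x₂ + fderiv ℝ c x₂ d)| ≤
      Lh * (‖c x₁ - c x₂‖ + ‖fderiv ℝ c x₁ - fderiv ℝ c x₂‖ * ‖d‖) := by
    intro d
    rw [← Real.norm_eq_abs]
    refine (hhLip.norm_sub_le _ _).trans ?_
    gcongr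
    rw [add_sub_add_comm, ← sub_apply]
    exact (norm_add_le _ _).trans (by gcongr; exact ContinuousLinearMap.le_opNorm _ _)
  have h4 : inner ℝ (g₁ - g₂) (d₂ - d₁) ≤ ‖g₁ - g₂‖ * (‖d₁‖ + ‖d₂‖) := by
    refine (real_inner_le_norm _ _).trans ?_
    gcongr
    rw [add_comm]
    exact norm_sub_le _ _
  have h5 : ‖d₁ - d₂‖ ^ 2 = γ * (inner ℝ (genGrad h c γ x₁ g₁) (d₂ - d₁) +
      inner ℝ (genGrad h c γ x₂ g₂) (d₁ - d₂)) := by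
    rw [mul_add, ← real_inner_smul_left, ← real_inner_smul_left, e1, e2,
      ← real_inner_self_eq_norm_sq]
    simp only [inner_neg_left, inner_sub_left, inner_sub_right, real_inner_comm]
    ring
  rw [h5]
  refine mul_le_mul_of_nonneg_left ?_ hγ.le
  have a1 := (abs_le.1 (h3 d₂)).2
  have a2 := (abs_le.1 (h3 d₁)).1
  simp only [inner_sub_left, inner_sub_right] at *
  ring_nf at *
  linarith

/-- Needed for measurability of the iterates. The stability estimate is majorized by a continuous
function of the perturbed data that vanishes at the base point. -/
theorem continuous_xPlus (hc : ContDiff ℝ 1 c) (hconv : ConvexOn ℝ univ h)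
    (hhLip : LipschitzWith Lh h) (hγ : 0 < γ) :
    Continuous fun p : Euc n × Euc n => xPlus h c γ p.1 p.2 := by
  have hJ : Continuous (fderiv ℝ c) := hc.continuous_fderiv one_ne_zero
  have hc0 := hc.continuous
  suffices hd : Continuous fun p : Euc n × Euc n => xPlus h c γ p.1 p.2 - p.1 by
    exact (hd.add continuous_fst).congr fun p => sub_add_cancel _ _
  refine continuous_iff_continuousAt.2 fun p => ?_
  rw [ContinuousAt, tendsto_iff_norm_sub_tendsto_zero]
  have hbd : ∀ r : Euc n × Euc n, ‖xPlus h c γ r.1 r.2 - r.1‖ ≤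
      γ * (‖r.2‖ + Lh * ‖fderiv ℝ c r.1‖) := by
    intro r
    rw [xPlus_sub hγ, norm_neg, norm_smul, Real.norm_of_nonneg hγ.le]
    gcongr
    exact norm_genGrad_le hconv hhLip hγ _ _
  set U : Euc n × Euc n → ℝ := fun r =>
    γ * ((‖r.2 - p.2‖ + Lh * ‖fderiv ℝ c r.1 - fderiv ℝ c p.1‖) *
        (γ * (‖r.2‖ + Lh * ‖fderiv ℝ c r.1‖) + γ * (‖p.2‖ + Lh * ‖fderiv ℝ c p.1‖)) +
        2 * Lh * ‖c r.1 - c p.1‖) with hU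
  have hUc : Continuous U := by fun_prop
  have hU0 : U p = 0 := by simp [hU]
  have hUt : Filter.Tendsto (fun r => √(U r)) (nhds p) (nhds 0) := by
    have := (Real.continuous_sqrt.comp hUc).tendsto p
    simpa [Function.comp_def, hU0] using this
  refine squeeze_zero (fun _ => norm_nonneg _) (fun r => ?_) hUt
  refine Real.le_sqrt_of_sq_le ?_
  refine (norm_xPlus_sub_sub_sq_le hconv hhLip hγ r.1 r.2 p.1 p.2).trans ?_
  rw [hU]
  dsimp only
  gcongr
  · exact hbd r
  · exact hbd p

theorem continuous_genGrad (hc : ContDiff ℝ 1 c) (hconv : ConvexOn ℝ univ h)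
    (hhLip : LipschitzWith Lh h) (hγ : 0 < γ) :
    Continuous fun p : Euc n × Euc n => genGrad h c γ p.1 p.2 := by
  unfold genGrad
  have := continuous_xPlus hc hconv hhLip hγ
  fun_prop

/-- Descent of `φ + h ∘ c` along a prox-linear step that uses an inexact gradient `g` of `φ`,
where `a` is the exact one. -/
theorem descent_step {φ : Euc n → ℝ} {x a g b : Euc n} {Lg : ℝ} (hc : ContDiff ℝ 1 c)
    (hcLip : LipschitzWith LJ (fderiv ℝ c)) (hconv : ConvexOn ℝ univ h)
    (hhLip : LipschitzWith Lh h) (hγ : 0 < γ)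
    (hφ : ∀ y, φ y ≤ φ x + inner ℝ a (y - x) + Lg / 2 * ‖y - x‖ ^ 2)
    (hb : b = genGrad h c γ x a) :
    φ (xPlus h c γ x g) + h (c (xPlus h c γ x g)) ≤
      φ x + h (c x) - (γ - (Lg + Lh * LJ) * γ ^ 2 / 2) * ‖genGrad h c γ x g‖ ^ 2 +
        γ * (inner ℝ (g - a) b + ‖g - a‖ ^ 2) := by
  have h1 := hφ (xPlus h c γ x g)
  have h2 := model_decrease (c := c) hconv hhLip hγ x g
  have h3 := norm_sub_sub_fderiv_le (hc.differentiable one_ne_zero) hcLip x (xPlus h c γ x g)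
  have h4 : h (c (xPlus h c γ x g)) - h (c x + fderiv ℝ c x (xPlus h c γ x g - x)) ≤
      Lh * (LJ / 2 * ‖xPlus h c γ x g - x‖ ^ 2) := by
    refine (le_abs_self _).trans ?_
    rw [← Real.norm_eq_abs]
    refine (hhLip.norm_sub_le _ _).trans ?_
    rw [← sub_sub]
    gcongr
  have h5 := norm_genGrad_sub_le (c := c) hconv hhLip hγ x g a
  rw [← hb] at h5
  -- Splitting off `b` isolates a term linear in the error `g - a`, which will have mean zero;
  -- nonexpansiveness bounds the rest quadratically.
  have h6 : inner ℝ (g - a) (genGrad h c γ x g) ≤ inner ℝ (g - a) b + ‖g - a‖ ^ 2 := by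
    have : genGrad h c γ x g = b + (genGrad h c γ x g - b) := by abel
    rw [this, inner_add_right, pow_two]
    gcongr
    exact (real_inner_le_norm _ _).trans (by gcongr)
  have h7 : ‖xPlus h c γ x g - x‖ ^ 2 = γ ^ 2 * ‖genGrad h c γ x g‖ ^ 2 := by
    rw [xPlus_sub hγ, norm_neg, norm_smul, Real.norm_of_nonneg hγ.le, mul_pow]
  have h8 : inner ℝ a (xPlus h c γ x g - x) = -(γ * inner ℝ a (genGrad h c γ x g)) := by
    rw [xPlus_sub hγ, inner_neg_right, inner_smul_right]
  have h9 := mul_le_mul_of_nonneg_left h6 hγ.le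
  rw [h7] at h1 h4
  rw [h8] at h1
  rw [inner_sub_left] at h9
  linarith

end StochNCO

/-! ### Standard Gaussian measure: density, Stein's identity and moments. -/

theorem hasFDerivAt_inner_mul_norm_sq_pow {E : Type*} [NormedAddCommGroup E]
    [InnerProductSpace ℝ E] (a : E) (p : ℕ) (x : E) :
    HasFDerivAt (fun x : E => inner ℝ a x * (‖x‖ ^ 2) ^ p)
      (inner ℝ a x • ((p * (‖x‖ ^ 2) ^ (p - 1)) • (2 • innerSL ℝ x)) +
        (‖x‖ ^ 2) ^ p • innerSL ℝ a) x := by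
  have h1 : HasFDerivAt (fun x : E => ‖x‖ ^ 2) (2 • innerSL ℝ x) x :=
    (hasStrictFDerivAt_norm_sq x).hasFDerivAt
  have h2 : HasFDerivAt (fun x : E => inner ℝ a x) (innerSL ℝ a) x := (innerSL ℝ a).hasFDerivAt
  have h3 := h2.mul (h1.pow p)
  convert! h3 using 1
  simp

section Gaussian

variable {E : Type*} [NormedAddCommGroup E] [InnerProductSpace ℝ E] [FiniteDimensional ℝ E]
  [MeasurableSpace E] [BorelSpace E]

theorem integrable_exp_neg_half_sq_norm :
    Integrable (fun x : E => Real.exp (-(1 / 2) * ‖x‖ ^ 2)) := by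
  have h := (GaussianFourier.integrable_cexp_neg_mul_sq_norm_add (V := E) (b := 1 / 2)
    (by norm_num) 0 0).norm
  refine h.congr (Filter.Eventually.of_forall fun x => ?_)
  have : (-(1 / 2) * (‖x‖ : ℂ) ^ 2 + 0 * (inner ℝ (0 : E) x : ℝ)) =
      ((-(1 / 2) * ‖x‖ ^ 2 : ℝ) : ℂ) := by push_cast; ring
  simp only [this, Complex.norm_exp_ofReal]

theorem integral_exp_neg_half_sq_norm_pos :
    0 < ∫ x : E, Real.exp (-(1 / 2) * ‖x‖ ^ 2) := by
  rw [GaussianFourier.integral_rexp_neg_mul_sq_norm (by norm_num)]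
  positivity

/-- The density of the standard Gaussian measure. -/
theorem stdGaussian_eq_withDensity :
    stdGaussian E = volume.withDensity fun x => ENNReal.ofReal
      ((∫ x : E, Real.exp (-(1 / 2) * ‖x‖ ^ 2))⁻¹ * Real.exp (-(1 / 2) * ‖x‖ ^ 2)) := by
  set Z := ∫ x : E, Real.exp (-(1 / 2) * ‖x‖ ^ 2) with hZ
  have hZ0 : 0 < Z := integral_exp_neg_half_sq_norm_pos
  have hint : Integrable fun x : E => Z⁻¹ * Real.exp (-(1 / 2) * ‖x‖ ^ 2) :=
    integrable_exp_neg_half_sq_norm.const_mul _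
  have : IsFiniteMeasure (volume.withDensity fun x : E => ENNReal.ofReal
      (Z⁻¹ * Real.exp (-(1 / 2) * ‖x‖ ^ 2))) := isFiniteMeasure_withDensity_ofReal hint.2
  refine Measure.ext_of_charFun ?_
  ext t
  rw [charFun_stdGaussian, charFun_apply, integral_withDensity_eq_integral_toReal_smul
    (by fun_prop) (by simp)]
  have h1 : ∀ x : E, (ENNReal.ofReal (Z⁻¹ * Real.exp (-(1 / 2) * ‖x‖ ^ 2))).toReal •
      Complex.exp ((inner ℝ x t : ℝ) * Complex.I) = (Z : ℂ)⁻¹ *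
        Complex.exp (-(1 / 2) * ‖x‖ ^ 2 + Complex.I * (inner ℝ t x : ℝ)) := by
    intro x
    rw [ENNReal.toReal_ofReal (by positivity), Complex.real_smul, Complex.exp_add,
      real_inner_comm, mul_comm Complex.I]
    push_cast
    ring
  simp_rw [h1]
  have h2 : (Z : ℂ) = (Real.pi / (1 / 2 : ℂ)) ^ (Module.finrank ℝ E / 2 : ℂ) := by
    have := GaussianFourier.integral_cexp_neg_mul_sq_norm (V := E) (b := 1 / 2) (by norm_num)
    rw [← this, hZ, ← integral_complex_ofReal]
    push_cast
    rfl
  rw [integral_const_mul, GaussianFourier.integral_cexp_neg_mul_sq_norm_add (by norm_num), ← h2,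
    ← mul_assoc, inv_mul_cancel₀ (by exact_mod_cast hZ0.ne'), one_mul, Complex.I_sq]
  congr 1
  ring

/-- **Stein's identity**: integration by parts for the standard Gaussian measure. -/
theorem integral_fderiv_stdGaussian {u : E → ℝ} (hu : Differentiable ℝ u) (a : E)
    (hi : Integrable u (stdGaussian E))
    (hi1 : Integrable (fun x => inner ℝ a x * u x) (stdGaussian E))
    (hi2 : Integrable (fun x => fderiv ℝ u x a) (stdGaussian E)) :
    ∫ x, fderiv ℝ u x a ∂stdGaussian E = ∫ x, inner ℝ a x * u x ∂stdGaussian E := by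
  set Z := ∫ x : E, Real.exp (-(1 / 2) * ‖x‖ ^ 2) with hZ
  have hZ0 : 0 < Z := integral_exp_neg_half_sq_norm_pos
  set w : E → ℝ := fun x => Z⁻¹ * Real.exp (-(1 / 2) * ‖x‖ ^ 2) with hw
  have hw0 : ∀ x, 0 ≤ w x := fun x => by positivity
  have hd : stdGaussian E = volume.withDensity fun x => ENNReal.ofReal (w x) :=
    stdGaussian_eq_withDensity
  have hm : Measurable fun x => ENNReal.ofReal (w x) := by fun_prop
  have hint : ∀ k : E → ℝ, Integrable k (stdGaussian E) → Integrable fun x => w x * k x := by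
    intro k hk
    rw [hd, integrable_withDensity_iff_integrable_smul' hm (by simp)] at hk
    simpa only [ENNReal.toReal_ofReal (hw0 _), smul_eq_mul] using hk
  have hval : ∀ k : E → ℝ, ∫ x, k x ∂stdGaussian E = ∫ x, w x * k x := by
    intro k
    rw [hd, integral_withDensity_eq_integral_toReal_smul hm (by simp)]
    simp only [ENNReal.toReal_ofReal (hw0 _), smul_eq_mul]
  have hwd : Differentiable ℝ w := by
    have : Differentiable ℝ fun x : E => ‖x‖ ^ 2 := (contDiff_norm_sq ℝ).differentiable two_ne_zero
    fun_prop
  -- The logarithmic derivative of the Gaussian weight is `-⟨a, x⟩`, which turns Lebesgue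
  -- integration by parts into Stein's identity.
  have hwf : ∀ x, fderiv ℝ w x a = -(w x * inner ℝ a x) := by
    intro x
    have h1 : HasFDerivAt (fun x : E => ‖x‖ ^ 2) (2 • innerSL ℝ x) x :=
      (hasStrictFDerivAt_norm_sq x).hasFDerivAt
    have h2 : HasFDerivAt w (Z⁻¹ • (Real.exp (-(1 / 2) * ‖x‖ ^ 2) •
        ((-(1 / 2) : ℝ) • (2 • innerSL ℝ x)))) x := ((h1.const_mul _).exp).const_mul _
    rw [h2.fderiv]
    simp [hw, real_inner_comm]
    ring
  have hi1' := hint _ hi1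
  have hi2' := hint _ hi2
  have key := integral_mul_fderiv_eq_neg_fderiv_mul_of_integrable (μ := volume) (f := u) (g := w)
    (v := a) (by simpa only [mul_comm] using hi2')
    (by
      simp_rw [hwf]
      refine hi1'.neg.congr (Filter.Eventually.of_forall fun x => ?_)
      simp only [Pi.neg_apply]
      ring) (by simpa only [mul_comm] using hint _ hi) (fun x _ => hu x) (fun x _ => hwd x)
  rw [hval, hval]
  have e1 : ∫ x, w x * fderiv ℝ u x a = ∫ x, fderiv ℝ u x a * w x := by simp only [mul_comm]
  rw [e1, eq_comm, ← neg_inj, ← key, ← integral_neg]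
  congr 1 with x
  rw [hwf]
  ring

theorem integrable_norm_pow_stdGaussian (p : ℕ) :
    Integrable (fun x : E => ‖x‖ ^ p) (stdGaussian E) :=
  (IsGaussian.memLp_id (stdGaussian E) p (by simp)).integrable_norm_pow'

theorem integrable_stdGaussian_of_norm_le {G : Type*} [NormedAddCommGroup G] {u : E → G}
    (hu : AEStronglyMeasurable u (stdGaussian E)) (C : ℝ) (p : ℕ) (h : ∀ x, ‖u x‖ ≤ C * ‖x‖ ^ p) :
    Integrable u (stdGaussian E) :=
  ((integrable_norm_pow_stdGaussian p).const_mul C).mono' hu (Filter.Eventually.of_forall h)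

/-- Stein's identity for `u(x) = ⟨a, x⟩ ‖x‖^(2p)` in direction `a`. At `p = 0` the truncated
exponent `p - 1` is harmless because its term carries the factor `2 * p`. -/
theorem integral_inner_sq_mul_norm_sq_pow_stdGaussian (a : E) (p : ℕ) :
    ∫ x, inner ℝ a x ^ 2 * (‖x‖ ^ 2) ^ p ∂stdGaussian E =
      ∫ x, (2 * p * (‖x‖ ^ 2) ^ (p - 1) * inner ℝ a x ^ 2 + ‖a‖ ^ 2 * (‖x‖ ^ 2) ^ p)
        ∂stdGaussian E := by
  have hb : ∀ x : E, ‖inner ℝ a x‖ ≤ ‖a‖ * ‖x‖ := fun x => norm_inner_le_norm a x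
  have hb2 : ∀ x : E, inner ℝ a x ^ 2 ≤ ‖a‖ ^ 2 * ‖x‖ ^ 2 := fun x => by
    rw [← sq_abs, ← Real.norm_eq_abs, ← mul_pow]
    gcongr
    exact hb x
  have hf : ∀ x, fderiv ℝ (fun x : E => inner ℝ a x * (‖x‖ ^ 2) ^ p) x a =
      2 * p * (‖x‖ ^ 2) ^ (p - 1) * inner ℝ a x ^ 2 + ‖a‖ ^ 2 * (‖x‖ ^ 2) ^ p := by
    intro x
    rw [(hasFDerivAt_inner_mul_norm_sq_pow a p x).fderiv]
    simp [real_inner_comm]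
    ring
  have h := integral_fderiv_stdGaussian (u := fun x : E => inner ℝ a x * (‖x‖ ^ 2) ^ p)
    (fun x => (hasFDerivAt_inner_mul_norm_sq_pow a p x).differentiableAt) a
    (integrable_stdGaussian_of_norm_le (by fun_prop) ‖a‖ (1 + 2 * p) fun x => by
      rw [norm_mul, pow_add, pow_one, ← mul_assoc, ← pow_mul, norm_pow, norm_norm]
      gcongr
      exact hb x)
    (integrable_stdGaussian_of_norm_le (by fun_prop) (‖a‖ ^ 2) (2 + 2 * p) fun x => by
      rw [← mul_assoc, ← pow_two, Real.norm_of_nonneg (by positivity), pow_add, ← mul_assoc,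
        ← pow_mul]
      gcongr
      exact hb2 x)
    (by
      simp_rw [hf]
      refine Integrable.add ?_ ?_
      · refine integrable_stdGaussian_of_norm_le (by fun_prop) (2 * p * ‖a‖ ^ 2)
          (2 * (p - 1) + 2) fun x => ?_
        rw [Real.norm_of_nonneg (by positivity), ← pow_mul]
        calc _ ≤ 2 * p * ‖x‖ ^ (2 * (p - 1)) * (‖a‖ ^ 2 * ‖x‖ ^ 2) := by gcongr; exact hb2 x
          _ = _ := by ring
      · simp_rw [← pow_mul]
        exact (integrable_norm_pow_stdGaussian _).const_mul _)
  simp_rw [hf] at h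
  rw [h]
  congr 1 with x
  ring

theorem integral_inner_sq_stdGaussian (a : E) :
    ∫ x, inner ℝ a x ^ 2 ∂stdGaussian E = ‖a‖ ^ 2 := by
  simpa using integral_inner_sq_mul_norm_sq_pow_stdGaussian a 0

/-- Sum the preceding identity over an orthonormal basis: the unit vectors contribute the dimension,
and the squared coordinates recombine to `‖x‖²`. -/
theorem integral_norm_sq_pow_succ_stdGaussian (p : ℕ) :
    ∫ x : E, (‖x‖ ^ 2) ^ (p + 1) ∂stdGaussian E =
      (Module.finrank ℝ E + 2 * p) * ∫ x : E, (‖x‖ ^ 2) ^ p ∂stdGaussian E := by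
  let b := stdOrthonormalBasis ℝ E
  have hsq : ∀ x : E, ∑ i, inner ℝ (b i) x ^ 2 = ‖x‖ ^ 2 := fun x => by
    rw [← b.sum_sq_norm_inner_right x]
    simp
  have hb2 : ∀ i (x : E), inner ℝ (b i) x ^ 2 ≤ ‖x‖ ^ 2 := fun i x => by
    rw [← hsq x]
    exact Finset.single_le_sum (f := fun i => inner ℝ (b i) x ^ 2) (fun _ _ => sq_nonneg _)
      (Finset.mem_univ i)
  have hi : ∀ i r, Integrable (fun x : E => inner ℝ (b i) x ^ 2 * (‖x‖ ^ 2) ^ r)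
      (stdGaussian E) := fun i r =>
    integrable_stdGaussian_of_norm_le (by fun_prop) 1 (2 + 2 * r) fun x => by
      rw [one_mul, Real.norm_of_nonneg (by positivity), pow_add, ← pow_mul]
      exact mul_le_mul_of_nonneg_right (hb2 i x) (by positivity)
  have hp : Integrable (fun x : E => (‖x‖ ^ 2) ^ p) (stdGaussian E) := by
    simp_rw [← pow_mul]
    exact integrable_norm_pow_stdGaussian _
  have h1 : ∀ x : E, (‖x‖ ^ 2) ^ (p + 1) = ∑ i, inner ℝ (b i) x ^ 2 * (‖x‖ ^ 2) ^ p := fun x => by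
    rw [← Finset.sum_mul, hsq, pow_succ']
  simp_rw [h1]
  rw [integral_finsetSum _ fun i _ => hi i p]
  simp_rw [integral_inner_sq_mul_norm_sq_pow_stdGaussian]
  have h2 : ∀ i x, 2 * p * (‖x‖ ^ 2) ^ (p - 1) * inner ℝ (b i) x ^ 2 +
      ‖b i‖ ^ 2 * (‖x‖ ^ 2) ^ p =
        2 * p * (inner ℝ (b i) x ^ 2 * (‖x‖ ^ 2) ^ (p - 1)) + (‖x‖ ^ 2) ^ p := fun i x => by
    rw [b.norm_eq_one]; ring
  simp_rw [h2]
  rw [← integral_finsetSum _ fun i _ => by exact ((hi i (p - 1)).const_mul (2 * p)).add hp, ← integral_const_mul]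
  congr 1 with x
  rw [Finset.sum_add_distrib, ← Finset.mul_sum, ← Finset.sum_mul, hsq]
  rcases p with _ | p
  · simp
  · simp [pow_succ]
    ring

theorem integral_norm_sq_stdGaussian :
    ∫ x : E, ‖x‖ ^ 2 ∂stdGaussian E = Module.finrank ℝ E := by
  simpa using integral_norm_sq_pow_succ_stdGaussian (E := E) 0

theorem integral_norm_pow_six_stdGaussian :
    ∫ x : E, ‖x‖ ^ 6 ∂stdGaussian E =
      (Module.finrank ℝ E + 4) * ((Module.finrank ℝ E + 2) * Module.finrank ℝ E) := by
  have h1 := integral_norm_sq_pow_succ_stdGaussian (E := E) 1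
  have h2 := integral_norm_sq_pow_succ_stdGaussian (E := E) 2
  simp only [← pow_mul] at h1 h2
  norm_num at h1 h2
  rw [h2, h1, integral_norm_sq_stdGaussian]

theorem integral_inner_sq_mul_norm_sq_stdGaussian (a : E) :
    ∫ x, inner ℝ a x ^ 2 * ‖x‖ ^ 2 ∂stdGaussian E = (Module.finrank ℝ E + 2) * ‖a‖ ^ 2 := by
  have h := integral_inner_sq_mul_norm_sq_pow_stdGaussian a 1
  simp only [pow_one, Nat.cast_one, mul_one, Nat.sub_self, pow_zero] at h
  rw [h, integral_add, integral_const_mul, integral_const_mul, integral_inner_sq_stdGaussian,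
    integral_norm_sq_stdGaussian]
  · ring
  · refine integrable_stdGaussian_of_norm_le (by fun_prop) (2 * ‖a‖ ^ 2) 2 fun x => ?_
    rw [norm_mul, Real.norm_of_nonneg zero_le_two, mul_assoc, ← mul_pow, norm_pow]
    gcongr
    exact norm_inner_le_norm a x
  · exact (integrable_norm_pow_stdGaussian 2).const_mul _

end Gaussian

/-! ### Gaussian smoothing and the random difference quotient. -/

section Smoothing

variable {E : Type*} [NormedAddCommGroup E] [InnerProductSpace ℝ E]

/-- The random difference quotient `((φ (x + μ v) - φ x) / μ) v`. -/
noncomputable def gaussDiff (φ : E → ℝ) (μ : ℝ) (x v : E) : E :=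
  ((φ (x + μ • v) - φ x) / μ) • v

variable {φ : E → ℝ} {K : ℝ≥0} {μ : ℝ}

section Bounds

variable [CompleteSpace E]

theorem abs_add_smul_sub_sub_inner_le (hφ : Differentiable ℝ φ)
    (hK : LipschitzWith K (gradient φ)) (x v : E) :
    |φ (x + μ • v) - φ x - μ * inner ℝ (gradient φ x) v| ≤ μ ^ 2 * K / 2 * ‖v‖ ^ 2 := by
  have h := abs_sub_sub_inner_gradient_le hφ hK x (x + μ • v)
  rw [add_sub_cancel_left, inner_smul_right, norm_smul, mul_pow, Real.norm_eq_abs, sq_abs] at h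
  exact h.trans_eq (by ring)

theorem abs_div_le (hφ : Differentiable ℝ φ) (hK : LipschitzWith K (gradient φ)) (hμ : 0 < μ)
    (x v : E) :
    |(φ (x + μ • v) - φ x) / μ| ≤ |inner ℝ (gradient φ x) v| + μ * K / 2 * ‖v‖ ^ 2 := by
  have h := abs_add_smul_sub_sub_inner_le (μ := μ) hφ hK x v
  rw [abs_div, abs_of_pos hμ, div_le_iff₀ hμ]
  have h1 : φ (x + μ • v) - φ x = (φ (x + μ • v) - φ x - μ * inner ℝ (gradient φ x) v) +
      μ * inner ℝ (gradient φ x) v := by ring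
  rw [h1]
  refine (abs_add_le _ _).trans ?_
  rw [abs_mul μ, abs_of_pos hμ]
  linarith

theorem norm_gaussDiff_le (hφ : Differentiable ℝ φ) (hK : LipschitzWith K (gradient φ))
    (hμ : 0 < μ) (x v : E) :
    ‖gaussDiff φ μ x v‖ ≤ ‖gradient φ x‖ * ‖v‖ ^ 2 + μ * K / 2 * ‖v‖ ^ 3 := by
  rw [gaussDiff, norm_smul, Real.norm_eq_abs]
  calc _ ≤ (‖gradient φ x‖ * ‖v‖ + μ * K / 2 * ‖v‖ ^ 2) * ‖v‖ := by
        gcongr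
        refine (abs_div_le hφ hK hμ x v).trans ?_
        gcongr
        exact abs_real_inner_le_norm _ _
    _ = _ := by ring

/-- The inner product is kept rather than bounded by Cauchy–Schwarz: the mean of `⟨a, v⟩² ‖v‖²` is
only linear in the dimension, whereas that of `‖v‖⁴` is quadratic. -/
theorem norm_gaussDiff_sq_le (hφ : Differentiable ℝ φ) (hK : LipschitzWith K (gradient φ))
    (hμ : 0 < μ) (x v : E) :
    ‖gaussDiff φ μ x v‖ ^ 2 ≤ 2 * (inner ℝ (gradient φ x) v ^ 2 * ‖v‖ ^ 2) +
      μ ^ 2 * K ^ 2 / 2 * ‖v‖ ^ 6 := by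
  rw [gaussDiff, norm_smul, Real.norm_eq_abs, mul_pow]
  have h1 : |(φ (x + μ • v) - φ x) / μ| ^ 2 ≤
      2 * (|inner ℝ (gradient φ x) v| ^ 2 + (μ * K / 2 * ‖v‖ ^ 2) ^ 2) :=
    (pow_le_pow_left₀ (abs_nonneg _) (abs_div_le hφ hK hμ x v) 2).trans add_sq_le
  rw [sq_abs (inner ℝ _ _)] at h1
  calc _ ≤ 2 * (inner ℝ (gradient φ x) v ^ 2 + (μ * K / 2 * ‖v‖ ^ 2) ^ 2) * ‖v‖ ^ 2 := by gcongr
    _ = _ := by ring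

end Bounds

variable [FiniteDimensional ℝ E] [MeasurableSpace E] [BorelSpace E]

/-- The Gaussian smoothing `x ↦ 𝔼 φ (x + μ v)` of `φ`. -/
noncomputable def gaussSmooth (φ : E → ℝ) (μ : ℝ) (x : E) : ℝ :=
  ∫ v, φ (x + μ • v) ∂stdGaussian E

/-- The gradient `x ↦ 𝔼 ∇φ (x + μ v)` of the Gaussian smoothing of `φ`. -/
noncomputable def gaussSmoothGrad (φ : E → ℝ) (μ : ℝ) (x : E) : E :=
  ∫ v, gradient φ (x + μ • v) ∂stdGaussian E

theorem integrable_comp_add_smul (hφ : Differentiable ℝ φ) (hK : LipschitzWith K (gradient φ))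
    (x : E) : Integrable (fun v => φ (x + μ • v)) (stdGaussian E) := by
  have hc := hφ.continuous
  have h1 : Integrable (fun v => φ (x + μ • v) - φ x - μ * inner ℝ (gradient φ x) v)
      (stdGaussian E) :=
    integrable_stdGaussian_of_norm_le (by fun_prop) _ 2
      fun v => abs_add_smul_sub_sub_inner_le hφ hK x v
  have h2 : Integrable (fun v => μ * inner ℝ (gradient φ x) v) (stdGaussian E) :=
    (integrable_stdGaussian_of_norm_le (by fun_prop) ‖gradient φ x‖ 1
      fun v => by simpa using norm_inner_le_norm (𝕜 := ℝ) (gradient φ x) v).const_mul _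
  refine ((h1.add h2).add (integrable_const (φ x))).congr (Filter.Eventually.of_forall fun v => ?_)
  simp only [Pi.add_apply]
  ring

theorem integrable_gradient_comp_add_smul (hK : LipschitzWith K (gradient φ)) (x : E) :
    Integrable (fun v => gradient φ (x + μ • v)) (stdGaussian E) := by
  have hc := hK.continuous
  have h1 : Integrable (fun v => gradient φ (x + μ • v) - gradient φ x) (stdGaussian E) :=
    integrable_stdGaussian_of_norm_le (by fun_prop) (K * |μ|) 1 fun v => by
      refine (hK.norm_sub_le _ _).trans ?_
      rw [add_sub_cancel_left, norm_smul, pow_one, mul_assoc, Real.norm_eq_abs]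
  refine (h1.add (integrable_const (gradient φ x))).congr
    (Filter.Eventually.of_forall fun v => ?_)
  simp

theorem integrable_gaussDiff (hφ : Differentiable ℝ φ) (hK : LipschitzWith K (gradient φ))
    (hμ : 0 < μ) (x : E) : Integrable (gaussDiff φ μ x) (stdGaussian E) := by
  have hc := hφ.continuous
  refine (((integrable_norm_pow_stdGaussian 2).const_mul _).add
    ((integrable_norm_pow_stdGaussian 3).const_mul _)).mono' ?_
      (Filter.Eventually.of_forall fun v => norm_gaussDiff_le hφ hK hμ x v)
  unfold gaussDiff
  fun_prop

/-- Average the quadratic bound of `φ` over the shifted base points `x + μ v`. Differentiability of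
the smoothing is not needed. -/
theorem gaussSmooth_le (hφ : Differentiable ℝ φ) (hK : LipschitzWith K (gradient φ)) (x y : E) :
    gaussSmooth φ μ y ≤
      gaussSmooth φ μ x + inner ℝ (gaussSmoothGrad φ μ x) (y - x) + K / 2 * ‖y - x‖ ^ 2 := by
  have hx := integrable_comp_add_smul (μ := μ) hφ hK x
  have hg := integrable_gradient_comp_add_smul (μ := μ) hK x
  have hg' : Integrable (fun v => inner ℝ (gradient φ (x + μ • v)) (y - x)) (stdGaussian E) :=
    hg.inner_const _
  have h1 : inner ℝ (gaussSmoothGrad φ μ x) (y - x) =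
      ∫ v, inner ℝ (gradient φ (x + μ • v)) (y - x) ∂stdGaussian E := by
    rw [gaussSmoothGrad, real_inner_comm, ← integral_inner hg]
    simp only [real_inner_comm]
  have h2 : K / 2 * ‖y - x‖ ^ 2 = ∫ _ : E, (K : ℝ) / 2 * ‖y - x‖ ^ 2 ∂stdGaussian E := by simp
  rw [h1, h2, gaussSmooth, gaussSmooth, ← integral_add hx hg',
    ← integral_add (by exact hx.add hg') (integrable_const _)]
  refine integral_mono (integrable_comp_add_smul hφ hK y) ((hx.add hg').add (integrable_const _))
    fun v => ?_
  have := (abs_le.1 (abs_sub_sub_inner_gradient_le hφ hK (x + μ • v) (y + μ • v))).2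
  rw [add_sub_add_right_eq_sub] at this
  dsimp only
  linarith

/-- The linear Taylor term has mean zero and may be subtracted for free, so the error is of order
`μ²`, with `𝔼 ‖v‖² = n`. -/
theorem abs_gaussSmooth_sub_le (hφ : Differentiable ℝ φ) (hK : LipschitzWith K (gradient φ))
    (x : E) : |gaussSmooth φ μ x - φ x| ≤ μ ^ 2 * K / 2 * Module.finrank ℝ E := by
  have hx := integrable_comp_add_smul (μ := μ) hφ hK x
  have hi : Integrable (fun v : E => μ * inner ℝ (gradient φ x) v) (stdGaussian E) :=
    (IsGaussian.integrable_id.const_inner _).const_mul _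
  have h0 : ∫ v : E, inner ℝ (gradient φ x) v ∂stdGaussian E = 0 := by
    rw [integral_inner (f := fun v : E => v) IsGaussian.integrable_id, integral_id_stdGaussian,
      inner_zero_right]
  have h1 : gaussSmooth φ μ x - φ x =
      ∫ v, (φ (x + μ • v) - φ x - μ * inner ℝ (gradient φ x) v) ∂stdGaussian E := by
    rw [integral_sub (by exact hx.sub (integrable_const _)) hi, integral_sub hx (integrable_const _),
      integral_const_mul, h0, gaussSmooth]
    simp
  rw [h1, ← integral_norm_sq_stdGaussian, ← integral_const_mul]
  refine (abs_integral_le_integral_abs).trans ?_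
  refine integral_mono_of_nonneg (Filter.Eventually.of_forall fun _ => abs_nonneg _)
    ((integrable_norm_pow_stdGaussian 2).const_mul _)
    (Filter.Eventually.of_forall fun v => abs_add_smul_sub_sub_inner_le hφ hK x v)

theorem lipschitzWith_gaussSmoothGrad (hK : LipschitzWith K (gradient φ)) :
    LipschitzWith K (gaussSmoothGrad φ μ) := by
  refine LipschitzWith.of_dist_le_mul fun x y => ?_
  rw [dist_eq_norm, dist_eq_norm, gaussSmoothGrad, gaussSmoothGrad,
    ← integral_sub (integrable_gradient_comp_add_smul hK x)
      (integrable_gradient_comp_add_smul hK y)]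
  refine (norm_integral_le_of_norm_le_const (C := K * ‖x - y‖)
    (Filter.Eventually.of_forall fun v => ?_)).trans_eq (by simp)
  simpa using hK.norm_sub_le (x + μ • v) (y + μ • v)

/-- Stein's identity for `v ↦ (φ(x + μ v) - φ x) / μ`; the chain rule produces a factor `μ` that
cancels the denominator. -/
theorem integral_gaussDiff (hφ : Differentiable ℝ φ) (hK : LipschitzWith K (gradient φ))
    (hμ : 0 < μ) (x : E) : ∫ v, gaussDiff φ μ x v ∂stdGaussian E = gaussSmoothGrad φ μ x := by
  refine ext_inner_left ℝ fun a => ?_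
  rw [gaussSmoothGrad, ← integral_inner (integrable_gaussDiff hφ hK hμ x),
    ← integral_inner (integrable_gradient_comp_add_smul hK x)]
  have hd : ∀ v, HasFDerivAt (fun v => (φ (x + μ • v) - φ x) / μ)
      (fderiv ℝ φ (x + μ • v)) v := by
    intro v
    have h1 : HasFDerivAt (fun v : E => x + μ • v) (μ • ContinuousLinearMap.id ℝ E) v :=
      ((hasFDerivAt_id v).const_smul μ).const_add x
    have h2 := (((hφ (x + μ • v)).hasFDerivAt.comp v h1).sub_const (φ x)).mul_const μ⁻¹
    simp only [div_eq_mul_inv]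
    convert! h2 using 1
    ext w
    simp
    field_simp
  have hf : ∀ v, fderiv ℝ (fun v => (φ (x + μ • v) - φ x) / μ) v a =
      inner ℝ a (gradient φ (x + μ • v)) := fun v => by
    rw [(hd v).fderiv, fderiv_eq_inner_gradient, real_inner_comm]
  have h := integral_fderiv_stdGaussian (u := fun v => (φ (x + μ • v) - φ x) / μ)
    (fun v => (hd v).differentiableAt) a
    (((integrable_comp_add_smul hφ hK x).sub (integrable_const _)).div_const _)
    (by
      refine ((integrable_gaussDiff hφ hK hμ x).const_inner a).congr
        (Filter.Eventually.of_forall fun v => ?_)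
      simp only [gaussDiff, inner_smul_right, mul_comm])
    (by
      simp_rw [hf]
      exact (integrable_gradient_comp_add_smul hK x).const_inner a)
  simp_rw [hf] at h
  rw [h]
  congr 1 with v
  rw [gaussDiff, inner_smul_right, mul_comm]

theorem integrable_norm_gaussDiff_sq (hφ : Differentiable ℝ φ)
    (hK : LipschitzWith K (gradient φ)) (hμ : 0 < μ) (x : E) :
    Integrable (fun v => ‖gaussDiff φ μ x v‖ ^ 2) (stdGaussian E) := by
  have hc := hφ.continuous
  have h1 : Integrable (fun v => inner ℝ (gradient φ x) v ^ 2 * ‖v‖ ^ 2) (stdGaussian E) :=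
    integrable_stdGaussian_of_norm_le (by fun_prop) (‖gradient φ x‖ ^ 2) 4 fun v => by
      rw [norm_mul, norm_pow, norm_pow, norm_norm]
      calc _ ≤ (‖gradient φ x‖ * ‖v‖) ^ 2 * ‖v‖ ^ 2 := by gcongr; exact norm_inner_le_norm _ _
        _ = _ := by ring
  refine ((h1.const_mul 2).add ((integrable_norm_pow_stdGaussian 6).const_mul
    (μ ^ 2 * K ^ 2 / 2))).mono' (by unfold gaussDiff; fun_prop)
    (Filter.Eventually.of_forall fun v => ?_)
  rw [Real.norm_of_nonneg (by positivity)]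
  exact norm_gaussDiff_sq_le hφ hK hμ x v

theorem integral_norm_gaussDiff_sq_le (hφ : Differentiable ℝ φ)
    (hK : LipschitzWith K (gradient φ)) (hμ : 0 < μ) (x : E) :
    ∫ v, ‖gaussDiff φ μ x v‖ ^ 2 ∂stdGaussian E ≤ 2 * (Module.finrank ℝ E + 4) *
      (‖gradient φ x‖ ^ 2 + μ ^ 2 * K ^ 2 * (Module.finrank ℝ E + 4) ^ 2) := by
  have h1 : Integrable (fun v => inner ℝ (gradient φ x) v ^ 2 * ‖v‖ ^ 2) (stdGaussian E) :=
    integrable_stdGaussian_of_norm_le (by fun_prop) (‖gradient φ x‖ ^ 2) 4 fun v => by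
      rw [norm_mul, norm_pow, norm_pow, norm_norm]
      calc _ ≤ (‖gradient φ x‖ * ‖v‖) ^ 2 * ‖v‖ ^ 2 := by gcongr; exact norm_inner_le_norm _ _
        _ = _ := by ring
  have h6 := (integrable_norm_pow_stdGaussian (E := E) 6).const_mul (μ ^ 2 * K ^ 2 / 2)
  refine (integral_mono (integrable_norm_gaussDiff_sq hφ hK hμ x) ((h1.const_mul 2).add h6)
    fun v => norm_gaussDiff_sq_le hφ hK hμ x v).trans ?_
  simp only [Pi.add_apply]
  rw [integral_add (h1.const_mul 2) h6, integral_const_mul, integral_const_mul,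
    integral_inner_sq_mul_norm_sq_stdGaussian, integral_norm_pow_six_stdGaussian]
  set d : ℝ := (Module.finrank ℝ E : ℝ)
  have hd : 0 ≤ d := Nat.cast_nonneg _
  have h2 : 2 * ((d + 2) * ‖gradient φ x‖ ^ 2) ≤ 2 * (d + 4) * ‖gradient φ x‖ ^ 2 := by
    rw [← mul_assoc]
    gcongr
    norm_num
  -- The sixth moment `(d + 4)(d + 2) d` is enlarged to a multiple of `(d + 4)³` to share the
  -- prefactor `2 (d + 4)`.
  have h3 : μ ^ 2 * K ^ 2 / 2 * ((d + 4) * ((d + 2) * d)) ≤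
      μ ^ 2 * K ^ 2 * (2 * (d + 4) * (d + 4) ^ 2) := by
    rw [div_mul_eq_mul_div, mul_div_assoc]
    gcongr
    rw [div_le_iff₀ two_pos]
    nlinarith [mul_nonneg hd hd, mul_nonneg (mul_nonneg hd hd) hd]
  linarith

end Smoothing

/-! ### Freezing independent variables by Fubini. -/

section Independence

variable {Ω A B E : Type*} [MeasurableSpace Ω] [MeasurableSpace A] [MeasurableSpace B]
  {P : Measure Ω} [IsProbabilityMeasure P]

/-- A conditionally centred vector is orthogonal to every function of the conditioning variable. -/
theorem integral_inner_eq_zero_of_indepFun [NormedAddCommGroup E] [InnerProductSpace ℝ E]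
    [CompleteSpace E] {Y : Ω → A} {S : Ω → B} (hY : Measurable Y) (hS : Measurable S)
    (hYS : IndepFun Y S P) {φ : A → E} {ψ : A → B → E}
    (hm : StronglyMeasurable fun p : A × B => (inner ℝ (φ p.1) (ψ p.1 p.2) : ℝ))
    (hψm : ∀ y, StronglyMeasurable (ψ y))
    (hi : Integrable (fun ω => (inner ℝ (φ (Y ω)) (ψ (Y ω) (S ω)) : ℝ)) P)
    (hψ : ∀ y, Integrable (fun ω => ψ y (S ω)) P) (h0 : ∀ y, ∫ ω, ψ y (S ω) ∂P = 0) :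
    ∫ ω, (inner ℝ (φ (Y ω)) (ψ (Y ω) (S ω)) : ℝ) ∂P = 0 := by
  have hmap := hYS.map_prod_eq_prod_map_map hY.aemeasurable hS.aemeasurable
  have : IsProbabilityMeasure (P.map Y) := Measure.isProbabilityMeasure_map hY.aemeasurable
  have : IsProbabilityMeasure (P.map S) := Measure.isProbabilityMeasure_map hS.aemeasurable
  have h1 : ∫ ω, (inner ℝ (φ (Y ω)) (ψ (Y ω) (S ω)) : ℝ) ∂P =
      ∫ p, (inner ℝ (φ p.1) (ψ p.1 p.2) : ℝ) ∂(P.map Y).prod (P.map S) := by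
    rw [← hmap, integral_map (hY.prodMk hS).aemeasurable hm.aestronglyMeasurable]
  have hi' : Integrable (fun p : A × B => (inner ℝ (φ p.1) (ψ p.1 p.2) : ℝ))
      ((P.map Y).prod (P.map S)) := by
    rw [← hmap, integrable_map_measure hm.aestronglyMeasurable (hY.prodMk hS).aemeasurable]
    exact hi
  rw [h1, integral_prod _ hi']
  have h2 : ∀ y, ∫ s, (inner ℝ (φ y) (ψ y s) : ℝ) ∂P.map S = 0 := by
    intro y
    rw [integral_inner, integral_map hS.aemeasurable (hψm y).aestronglyMeasurable, h0,
      inner_zero_right]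
    rw [integrable_map_measure (hψm y).aestronglyMeasurable hS.aemeasurable]
    exact hψ y
  simp [h2]

omit [IsProbabilityMeasure P] in
theorem MeasureTheory.MemLp.integrable_real_inner [NormedAddCommGroup E] [InnerProductSpace ℝ E]
    {X Y : Ω → E} (hX : MemLp X 2 P) (hY : MemLp Y 2 P) :
    Integrable (fun ω => (inner ℝ (X ω) (Y ω) : ℝ)) P :=
  (hX.norm.integrable_mul hY.norm).mono' (hX.1.inner hY.1)
    (Filter.Eventually.of_forall fun _ => norm_inner_le_norm _ _)

/-- A bound on the integral over `V` for each frozen value of `W` passes to the expectation.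
Integrability is part of the conclusion, since `H` is nonnegative and `b` dominates its partial
integrals. -/
theorem integrable_and_integral_le_of_indepFun {W : Ω → A} {V : Ω → B} (hW : Measurable W)
    (hV : Measurable V) (hWV : IndepFun W V P) {H : A → B → ℝ}
    (hH : Measurable fun p : A × B => H p.1 p.2) (hH0 : ∀ w x, 0 ≤ H w x) {b : A → ℝ}
    (hb : Measurable b) (hbi : Integrable (fun ω => b (W ω)) P)
    (hHi : ∀ w, Integrable (H w) (P.map V)) (hHb : ∀ w, ∫ x, H w x ∂P.map V ≤ b w) :
    Integrable (fun ω => H (W ω) (V ω)) P ∧ ∫ ω, H (W ω) (V ω) ∂P ≤ ∫ ω, b (W ω) ∂P := by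
  have hmap := hWV.map_prod_eq_prod_map_map hW.aemeasurable hV.aemeasurable
  have : IsProbabilityMeasure (P.map W) := Measure.isProbabilityMeasure_map hW.aemeasurable
  have : IsProbabilityMeasure (P.map V) := Measure.isProbabilityMeasure_map hV.aemeasurable
  have hbi' : Integrable b (P.map W) :=
    (integrable_map_measure hb.aestronglyMeasurable hW.aemeasurable).2 hbi
  have hint : Integrable (fun p : A × B => H p.1 p.2) ((P.map W).prod (P.map V)) := by
    rw [integrable_prod_iff hH.aestronglyMeasurable]
    refine ⟨Filter.Eventually.of_forall hHi, hbi'.mono'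
      hH.aestronglyMeasurable.norm.integral_prod_right' (Filter.Eventually.of_forall fun w => ?_)⟩
    simp only [Real.norm_of_nonneg (hH0 _ _)]
    rw [Real.norm_of_nonneg (integral_nonneg (hH0 w))]
    exact hHb w
  constructor
  · rw [← hmap, integrable_map_measure hH.aestronglyMeasurable (hW.prodMk hV).aemeasurable] at hint
    exact hint
  · have h1 : ∫ ω, H (W ω) (V ω) ∂P = ∫ p, H p.1 p.2 ∂(P.map W).prod (P.map V) := by
      rw [← hmap, integral_map (hW.prodMk hV).aemeasurable hH.aestronglyMeasurable]
    rw [h1, integral_prod _ hint, ← integral_map hW.aemeasurable hb.aestronglyMeasurable]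
    exact integral_mono hint.integral_prod_left hbi' hHb

/-- Reassociate the product law of the triple. This lets the state and the oracle sample be frozen
together against the Gaussian direction. -/
theorem ProbabilityTheory.IndepFun.prodMk_of_prodMk {C : Type*} [MeasurableSpace C] {X : Ω → A}
    {Y : Ω → B} {Z : Ω → C} (hX : Measurable X) (hY : Measurable Y) (hZ : Measurable Z)
    (h : IndepFun X (fun ω => (Y ω, Z ω)) P) (hYZ : IndepFun Y Z P) :
    IndepFun (fun ω => (X ω, Y ω)) Z P := by
  have : IsProbabilityMeasure (P.map X) := Measure.isProbabilityMeasure_map hX.aemeasurable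
  have : IsProbabilityMeasure (P.map Y) := Measure.isProbabilityMeasure_map hY.aemeasurable
  have : IsProbabilityMeasure (P.map Z) := Measure.isProbabilityMeasure_map hZ.aemeasurable
  have hXY : IndepFun X Y P := h.comp measurable_id measurable_fst
  rw [indepFun_iff_map_prod_eq_prod_map_map (hX.prodMk hY).aemeasurable hZ.aemeasurable,
    hXY.map_prod_eq_prod_map_map hX.aemeasurable hY.aemeasurable]
  have h1 := h.map_prod_eq_prod_map_map hX.aemeasurable (hY.prodMk hZ).aemeasurable
  rw [hYZ.map_prod_eq_prod_map_map hY.aemeasurable hZ.aemeasurable] at h1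
  have h2 := Measure.prodAssoc_prod (μ := P.map X) (ν := P.map Y) (τ := P.map Z)
  rw [← h1] at h2
  have h3 := congrArg (Measure.map MeasurableEquiv.prodAssoc.symm) h2
  rw [Measure.map_map (by fun_prop) (by fun_prop), Measure.map_map (by fun_prop)
    (hX.prodMk (hY.prodMk hZ))] at h3
  simpa [Function.comp_def, MeasurableEquiv.prodAssoc] using h3.symm

end Independence

/-! ### Joint measurability of functions continuous in the point and measurable in the sample. -/

namespace StochNCO

section Measurability

variable {n : ℕ} {Ξ : Type*} [MeasurableSpace Ξ] {F : Euc n → Ξ → ℝ} {μ : ℝ} {K : ℝ≥0}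

theorem measurable_uncurry_oracle (hFmeas : ∀ x, Measurable (F x))
    (hFdiff : ∀ s, ContDiff ℝ 1 (fun x => F x s)) :
    Measurable fun p : Euc n × Ξ => F p.1 p.2 :=
  measurable_uncurry_of_continuous_of_measurable (fun s => (hFdiff s).continuous) hFmeas

theorem measurable_zoGrad (hFmeas : ∀ x, Measurable (F x))
    (hFdiff : ∀ s, ContDiff ℝ 1 (fun x => F x s)) :
    Measurable fun p : Euc n × Ξ × Euc n => zoGrad F μ p.1 p.2.1 p.2.2 := by
  have hF := measurable_uncurry_oracle hFmeas hFdiff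
  have h1 : Measurable fun p : Euc n × Ξ × Euc n => F (p.1 + μ • p.2.2) p.2.1 :=
    hF.comp (f := fun p : Euc n × Ξ × Euc n => (p.1 + μ • p.2.2, p.2.1)) (by fun_prop)
  have h2 : Measurable fun p : Euc n × Ξ × Euc n => F p.1 p.2.1 :=
    hF.comp (f := fun p : Euc n × Ξ × Euc n => (p.1, p.2.1)) (by fun_prop)
  unfold zoGrad
  fun_prop

/-- Each coordinate of the gradient is a limit of difference quotients with steps `1 / (k + 1)`,
which are measurable in the sample. -/
theorem measurable_stochGrad_apply (hFmeas : ∀ x, Measurable (F x))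
    (hFdiff : ∀ s, ContDiff ℝ 1 (fun x => F x s)) (x : Euc n) : Measurable (stochGrad F x) := by
  let b := stdOrthonormalBasis ℝ (Euc n)
  have h1 : ∀ s, stochGrad F x s = ∑ i, (fderiv ℝ (fun y => F y s) x (b i)) • b i := by
    intro s
    refine (b.sum_repr' (stochGrad F x s)).symm.trans (Finset.sum_congr rfl fun i _ => ?_)
    rw [fderiv_eq_inner_gradient, real_inner_comm, stochGrad]
  have h2 : ∀ i, Measurable fun s => fderiv ℝ (fun y => F y s) x (b i) := by
    intro i
    refine measurable_of_tendsto_metrizable (f := fun (k : ℕ) s =>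
      (k + 1 : ℝ) * (F (x + (k + 1 : ℝ)⁻¹ • b i) s - F x s)) (fun k => ?_) ?_
    · exact ((hFmeas _).sub (hFmeas _)).const_mul _
    · rw [tendsto_pi_nhds]
      intro s
      have hd := ((hFdiff s).differentiable one_ne_zero x).hasFDerivAt.hasLineDerivAt (b i)
      have ht := hd.tendsto_slope_zero
      have hk : Filter.Tendsto (fun k : ℕ => ((k : ℝ) + 1)⁻¹) Filter.atTop
          (nhdsWithin 0 {0}ᶜ) := by
        refine tendsto_nhdsWithin_iff.2 ⟨?_, Filter.Eventually.of_forall fun k => ?_⟩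
        · simpa using tendsto_one_div_add_atTop_nhds_zero_nat (𝕜 := ℝ)
        · simp only [mem_compl_iff, mem_singleton_iff, inv_eq_zero]
          positivity
      have := ht.comp hk
      simpa [Function.comp_def] using this
  simp_rw [funext h1]
  fun_prop

theorem measurable_stochGrad (hFmeas : ∀ x, Measurable (F x))
    (hFdiff : ∀ s, ContDiff ℝ 1 (fun x => F x s))
    (hFLip : ∀ s, LipschitzWith K (fun x => stochGrad F x s)) :
    Measurable fun p : Euc n × Ξ => stochGrad F p.1 p.2 :=
  measurable_uncurry_of_continuous_of_measurable (fun s => (hFLip s).continuous)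
    (measurable_stochGrad_apply hFmeas hFdiff)

theorem measurable_zoGrad_comp {Ω : Type*} {_ : MeasurableSpace Ω}
    (hFmeas : ∀ x, Measurable (F x)) (hFdiff : ∀ s, ContDiff ℝ 1 (fun x => F x s))
    {Y : Ω → Euc n} {ξ : Ω → Ξ} {v : Ω → Euc n} (hY : Measurable Y) (hξ : Measurable ξ)
    (hv : Measurable v) : Measurable fun ω => zoGrad F μ (Y ω) (ξ ω) (v ω) := by
  have h := (measurable_zoGrad (μ := μ) hFmeas hFdiff).comp (hY.prodMk (hξ.prodMk hv))
  exact h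

theorem measurable_batchGrad {Ω : Type*} {_ : MeasurableSpace Ω} (hFmeas : ∀ x, Measurable (F x))
    (hFdiff : ∀ s, ContDiff ℝ 1 (fun x => F x s)) {m : ℕ} {Y : Ω → Euc n} (hY : Measurable Y)
    {ξ : ℕ → Ω → Ξ} {v : ℕ → Ω → Euc n} (hξ : ∀ i < m, Measurable (ξ i))
    (hv : ∀ i < m, Measurable (v i)) :
    Measurable fun ω => batchGrad F μ m (Y ω) (fun i => ξ i ω) (fun i => v i ω) := by
  have h := Finset.measurable_fun_sum (Finset.range m)
    (f := fun i ω => zoGrad F μ (Y ω) (ξ i ω) (v i ω)) fun i hi =>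
      measurable_zoGrad_comp hFmeas hFdiff hY (hξ i (Finset.mem_range.1 hi))
        (hv i (Finset.mem_range.1 hi))
  have h2 := (measurable_const_smul (1 / (m : ℝ)) : Measurable fun x : Euc n => _).comp h
  exact h2

end Measurability

end StochNCO

section Smoothing

variable {E : Type*} [NormedAddCommGroup E] [InnerProductSpace ℝ E] [FiniteDimensional ℝ E]
  [MeasurableSpace E] [BorelSpace E] {φ : E → ℝ} {K : ℝ≥0} {μ : ℝ}

/-- A crude bound that carries boundedness of `∇f` along the iterates over to the smoothed gradient;
it is used for integrability only. -/
theorem norm_gaussSmoothGrad_le (hK : LipschitzWith K (gradient φ)) (x : E) :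
    ‖gaussSmoothGrad φ μ x‖ ≤ ‖gradient φ x‖ + K * |μ| * ∫ v : E, ‖v‖ ∂stdGaussian E := by
  have hi := integrable_gradient_comp_add_smul (μ := μ) hK x
  have hn : Integrable (fun v : E => ‖v‖) (stdGaussian E) := by
    simpa using integrable_norm_pow_stdGaussian (E := E) 1
  have h1 : ∀ v, ‖gradient φ (x + μ • v)‖ ≤ ‖gradient φ x‖ + K * |μ| * ‖v‖ := by
    intro v
    have h := hK.norm_sub_le (x + μ • v) x
    rw [add_sub_cancel_left, norm_smul, ← mul_assoc, Real.norm_eq_abs] at h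
    have := norm_le_norm_add_norm_sub (gradient φ x) (gradient φ (x + μ • v))
    rw [norm_sub_rev] at this
    linarith
  refine (norm_integral_le_integral_norm _).trans ((integral_mono hi.norm
    ((integrable_const _).add (hn.const_mul _)) h1).trans_eq ?_)
  simp only [Pi.add_apply]
  rw [integral_add (integrable_const _) (hn.const_mul _), integral_const_mul]
  simp

end Smoothing

/-! ### One sample: conditional mean and second moment. -/

namespace StochNCO

variable {n : ℕ} {Ξ Ω : Type*} [MeasurableSpace Ξ] [MeasurableSpace Ω]

/-- A stochastic zeroth-order oracle, smooth in the decision variable. -/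
structure SmoothOracle (F : Euc n → Ξ → ℝ) (K : ℝ≥0) : Prop where
  meas : ∀ x, Measurable (F x)
  diff : ∀ s, ContDiff ℝ 1 (fun x => F x s)
  lip : ∀ s, LipschitzWith K (gradient fun x => F x s)

/-- A sample `ξ` that makes the oracle unbiased, with an independent Gaussian direction `v`. -/
structure UnbiasedSample (P : Measure Ω) (F : Euc n → Ξ → ℝ) (f : Euc n → ℝ) (ξ : Ω → Ξ)
    (v : Ω → Euc n) : Prop where
  meas_sample : Measurable ξ
  meas_dir : Measurable v
  law_dir : P.map v = stdGaussian (Euc n)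
  indep : IndepFun ξ v P
  integrable : ∀ x, Integrable (fun ω => F x (ξ ω)) P
  mean : ∀ x, ∫ ω, F x (ξ ω) ∂P = f x
  integrable_grad : ∀ x, Integrable (fun ω => stochGrad F x (ξ ω)) P
  mean_grad : ∀ x, ∫ ω, stochGrad F x (ξ ω) ∂P = gradient f x

/-- The noise of the zeroth-order gradient estimate. -/
noncomputable def zoNoise (F : Euc n → Ξ → ℝ) (f : Euc n → ℝ) (μ : ℝ) (x : Euc n) (s : Ξ) (v : Euc n) : Euc n :=
  zoGrad F μ x s v - gaussSmoothGrad f μ x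

variable {P : Measure Ω} [IsProbabilityMeasure P] {F : Euc n → Ξ → ℝ} {f : Euc n → ℝ} {K : ℝ≥0}
  {μ : ℝ} {ξ : Ω → Ξ} {v : Ω → Euc n}

theorem SmoothOracle.measurable_zoNoise {A : Type*} {_ : MeasurableSpace A}
    (hF : SmoothOracle F K) (hfK : LipschitzWith K (gradient f)) {y : A → Euc n} {s : A → Ξ}
    {w : A → Euc n} (hy : Measurable y) (hs : Measurable s) (hw : Measurable w) :
    Measurable fun a => zoNoise F f μ (y a) (s a) (w a) :=
  (measurable_zoGrad_comp hF.meas hF.diff hy hs hw).sub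
    ((lipschitzWith_gaussSmoothGrad hfK).continuous.measurable.comp hy)

theorem SmoothOracle.measurable_stochGrad (hF : SmoothOracle F K) :
    Measurable fun p : Euc n × Ξ => stochGrad F p.1 p.2 :=
  StochNCO.measurable_stochGrad hF.meas hF.diff hF.lip

theorem UnbiasedSample.mean_zoGrad (hS : UnbiasedSample P F f ξ v) (hF : SmoothOracle F K)
    (hf : Differentiable ℝ f) (hfK : LipschitzWith K (gradient f)) (hμ : 0 < μ) (x : Euc n) :
    Integrable (fun ω => zoGrad F μ x (ξ ω) (v ω)) P ∧
      ∫ ω, zoGrad F μ x (ξ ω) (v ω) ∂P = gaussSmoothGrad f μ x := by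
  have hξ := hS.meas_sample
  have hmap := hS.indep.map_prod_eq_prod_map_map hξ.aemeasurable hS.meas_dir.aemeasurable
  rw [hS.law_dir] at hmap
  have : IsProbabilityMeasure (P.map ξ) := Measure.isProbabilityMeasure_map hξ.aemeasurable
  have hm : Measurable fun p : Ξ × Euc n => zoGrad F μ x p.1 p.2 :=
    measurable_zoGrad_comp hF.meas hF.diff measurable_const measurable_fst measurable_snd
  have hgm := measurable_stochGrad_apply hF.meas hF.diff x
  have hg : Integrable (stochGrad F x) (P.map ξ) :=
    (integrable_map_measure hgm.aestronglyMeasurable hξ.aemeasurable).2 (hS.integrable_grad x)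
  have hFi : ∀ y, Integrable (F y) (P.map ξ) := fun y =>
    (integrable_map_measure (hF.meas y).aestronglyMeasurable hξ.aemeasurable).2 (hS.integrable y)
  have hint : Integrable (fun p : Ξ × Euc n => zoGrad F μ x p.1 p.2)
      ((P.map ξ).prod (stdGaussian (Euc n))) := by
    have h1 := hg.norm.mul_prod (integrable_norm_pow_stdGaussian (E := Euc n) 2)
    have h2 := (integrable_const (μ := P.map ξ) (μ * K / 2)).mul_prod
      (integrable_norm_pow_stdGaussian (E := Euc n) 3)
    exact (h1.add h2).mono' hm.aestronglyMeasurable (Filter.Eventually.of_forall fun p =>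
      norm_gaussDiff_le ((hF.diff p.1).differentiable one_ne_zero) (hF.lip p.1) hμ x p.2)
  constructor
  · rw [← hmap, integrable_map_measure hm.aestronglyMeasurable
      (hξ.prodMk hS.meas_dir).aemeasurable] at hint
    exact hint
  · have h1 : ∫ ω, zoGrad F μ x (ξ ω) (v ω) ∂P =
        ∫ p, zoGrad F μ x p.1 p.2 ∂(P.map ξ).prod (stdGaussian (Euc n)) := by
      rw [← hmap, integral_map (hξ.prodMk hS.meas_dir).aemeasurable hm.aestronglyMeasurable]
    -- Integrating over the oracle sample first, with the direction fixed, replaces `F` by `f`; the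
    -- Gaussian integral then gives the smoothed gradient.
    rw [h1, integral_prod_symm _ hint, ← integral_gaussDiff hf hfK hμ x]
    refine integral_congr_ae (Filter.Eventually.of_forall fun w => ?_)
    simp only [zoGrad, gaussDiff]
    rw [integral_smul_const, integral_div, integral_sub (hFi _) (hFi _),
      integral_map hξ.aemeasurable (hF.meas _).aestronglyMeasurable,
      integral_map hξ.aemeasurable (hF.meas _).aestronglyMeasurable, hS.mean, hS.mean]

theorem UnbiasedSample.mean_zoNoise (hS : UnbiasedSample P F f ξ v) (hF : SmoothOracle F K)
    (hf : Differentiable ℝ f) (hfK : LipschitzWith K (gradient f)) (hμ : 0 < μ) (x : Euc n) :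
    Integrable (fun ω => zoNoise F f μ x (ξ ω) (v ω)) P ∧
      ∫ ω, zoNoise F f μ x (ξ ω) (v ω) ∂P = 0 := by
  obtain ⟨h1, h2⟩ := hS.mean_zoGrad hF hf hfK hμ x
  refine ⟨h1.sub (integrable_const _), ?_⟩
  simp only [zoNoise]
  rw [integral_sub h1 (integrable_const _), h2]
  simp

theorem UnbiasedSample.integral_inner_zoNoise {A : Type*} [MeasurableSpace A] {W : Ω → A}
    {y φ : A → Euc n} (hS : UnbiasedSample P F f ξ v) (hF : SmoothOracle F K)
    (hf : Differentiable ℝ f) (hfK : LipschitzWith K (gradient f)) (hμ : 0 < μ)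
    (hW : Measurable W) (hy : Measurable y) (hφ : Measurable φ)
    (hind : IndepFun W (fun ω => (ξ ω, v ω)) P)
    (hi : Integrable (fun ω => (inner ℝ (φ (W ω)) (zoNoise F f μ (y (W ω)) (ξ ω) (v ω)) : ℝ)) P) :
    ∫ ω, (inner ℝ (φ (W ω)) (zoNoise F f μ (y (W ω)) (ξ ω) (v ω)) : ℝ) ∂P = 0 := by
  have hm : Measurable fun p : A × Ξ × Euc n => zoNoise F f μ (y p.1) p.2.1 p.2.2 :=
    hF.measurable_zoNoise hfK (hy.comp measurable_fst) measurable_snd.fst measurable_snd.snd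
  exact integral_inner_eq_zero_of_indepFun (φ := φ)
    (ψ := fun w s => zoNoise F f μ (y w) s.1 s.2) hW
    (hS.meas_sample.prodMk hS.meas_dir) hind
    ((hφ.comp measurable_fst).inner hm).stronglyMeasurable
    (fun w => (hF.measurable_zoNoise hfK measurable_const measurable_fst
      measurable_snd).stronglyMeasurable) hi
    (fun w => (hS.mean_zoNoise hF hf hfK hμ (y w)).1)
    (fun w => (hS.mean_zoNoise hF hf hfK hμ (y w)).2)

section State

variable {Y : Ω → Euc n} {κ σ : ℝ}

theorem memLp_gradient_of_ae_le (hY : Measurable Y) (hfK : LipschitzWith K (gradient f))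
    (hκ : ∀ᵐ ω ∂P, ‖gradient f (Y ω)‖ ≤ κ) : MemLp (fun ω => gradient f (Y ω)) 2 P :=
  MemLp.of_bound (hfK.continuous.measurable.comp hY).aestronglyMeasurable κ hκ

theorem memLp_gaussSmoothGrad_of_ae_le (hY : Measurable Y) (hfK : LipschitzWith K (gradient f))
    (hκ : ∀ᵐ ω ∂P, ‖gradient f (Y ω)‖ ≤ κ) :
    MemLp (fun ω => gaussSmoothGrad f μ (Y ω)) 2 P := by
  refine MemLp.of_bound ((lipschitzWith_gaussSmoothGrad hfK).continuous.measurable.comp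
    hY).aestronglyMeasurable (κ + K * |μ| * ∫ v : Euc n, ‖v‖ ∂stdGaussian (Euc n)) ?_
  filter_upwards [hκ] with ω hω
  exact (norm_gaussSmoothGrad_le hfK (Y ω)).trans (by gcongr)

/-- Bias-variance decomposition: the cross term vanishes because the sample is independent of the
state and the oracle gradient is unbiased at each fixed point. -/
theorem UnbiasedSample.integral_norm_stochGrad_sq_le (hS : UnbiasedSample P F f ξ v)
    (hF : SmoothOracle F K) (hfK : LipschitzWith K (gradient f)) (hY : Measurable Y)
    (hind : IndepFun Y ξ P) (hκ : ∀ᵐ ω ∂P, ‖gradient f (Y ω)‖ ≤ κ)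
    (hvi : Integrable (fun ω => ‖stochGrad F (Y ω) (ξ ω) - gradient f (Y ω)‖ ^ 2) P)
    (hvar : ∫ ω, ‖stochGrad F (Y ω) (ξ ω) - gradient f (Y ω)‖ ^ 2 ∂P ≤ σ ^ 2) :
    Integrable (fun ω => ‖stochGrad F (Y ω) (ξ ω)‖ ^ 2) P ∧
      ∫ ω, ‖stochGrad F (Y ω) (ξ ω)‖ ^ 2 ∂P ≤ κ ^ 2 + σ ^ 2 := by
  have hfm : Measurable (gradient f) := hfK.continuous.measurable
  have hm : Measurable fun p : Euc n × Ξ => stochGrad F p.1 p.2 - gradient f p.1 :=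
    hF.measurable_stochGrad.sub (hfm.comp measurable_fst)
  have hg := memLp_gradient_of_ae_le hY hfK hκ
  have hd : MemLp (fun ω => stochGrad F (Y ω) (ξ ω) - gradient f (Y ω)) 2 P :=
    (memLp_two_iff_integrable_sq_norm
      (hm.comp (hY.prodMk hS.meas_sample)).aestronglyMeasurable).2 hvi
  have hcross := hg.integrable_real_inner hd
  have h0 : ∫ ω, (inner ℝ (gradient f (Y ω))
      (stochGrad F (Y ω) (ξ ω) - gradient f (Y ω)) : ℝ) ∂P = 0 :=
    integral_inner_eq_zero_of_indepFun (φ := gradient f)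
      (ψ := fun x s => stochGrad F x s - gradient f x) hY hS.meas_sample hind
      ((hfm.comp measurable_fst).inner hm).stronglyMeasurable
      (fun x => (hm.comp (measurable_const.prodMk measurable_id)).stronglyMeasurable) hcross
      (fun x => (hS.integrable_grad x).sub (integrable_const _))
      (fun x => by
        rw [integral_sub (hS.integrable_grad x) (integrable_const _), hS.mean_grad]
        simp)
  have hgi := hg.integrable_norm_pow two_ne_zero
  have hgi2 : Integrable (fun ω => ‖gradient f (Y ω)‖ ^ 2) P := by simpa using hgi
  have hexp : ∀ ω, ‖stochGrad F (Y ω) (ξ ω)‖ ^ 2 = ‖gradient f (Y ω)‖ ^ 2 +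
      2 * inner ℝ (gradient f (Y ω)) (stochGrad F (Y ω) (ξ ω) - gradient f (Y ω)) +
        ‖stochGrad F (Y ω) (ξ ω) - gradient f (Y ω)‖ ^ 2 := fun ω => by
    rw [← norm_add_sq_real, add_sub_cancel]
  have hi1 := hgi2.add (hcross.const_mul 2)
  simp_rw [hexp]
  refine ⟨hi1.add hvi, ?_⟩
  rw [integral_add (by exact hi1) hvi, integral_add hgi2 (hcross.const_mul 2), integral_const_mul,
    h0]
  have : ∫ ω, ‖gradient f (Y ω)‖ ^ 2 ∂P ≤ κ ^ 2 := by
    refine (integral_mono_ae (g := fun _ => κ ^ 2) hgi2 (integrable_const _) ?_).trans_eq (by simp)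
    filter_upwards [hκ] with ω hω
    gcongr
  linarith

/-- With state and sample frozen, the Gaussian moment bound applies to `F(·, ξ)`; averaging `‖G‖²`
then brings in `κ² + σ²`. -/
theorem UnbiasedSample.integral_norm_zoGrad_sq_le (hS : UnbiasedSample P F f ξ v)
    (hF : SmoothOracle F K) (hfK : LipschitzWith K (gradient f)) (hμ : 0 < μ) (hY : Measurable Y)
    (hind : IndepFun Y (fun ω => (ξ ω, v ω)) P) (hκ : ∀ᵐ ω ∂P, ‖gradient f (Y ω)‖ ≤ κ)
    (hvi : Integrable (fun ω => ‖stochGrad F (Y ω) (ξ ω) - gradient f (Y ω)‖ ^ 2) P)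
    (hvar : ∫ ω, ‖stochGrad F (Y ω) (ξ ω) - gradient f (Y ω)‖ ^ 2 ∂P ≤ σ ^ 2) :
    Integrable (fun ω => ‖zoGrad F μ (Y ω) (ξ ω) (v ω)‖ ^ 2) P ∧
      ∫ ω, ‖zoGrad F μ (Y ω) (ξ ω) (v ω)‖ ^ 2 ∂P ≤
        2 * (n + 4) * (κ ^ 2 + σ ^ 2 + μ ^ 2 * K ^ 2 * (n + 4) ^ 2) := by
  obtain ⟨h1, h2⟩ := hS.integral_norm_stochGrad_sq_le hF hfK hY
    (hind.comp measurable_id measurable_fst) hκ hvi hvar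
  have hm : Measurable fun p : (Euc n × Ξ) × Euc n => ‖zoGrad F μ p.1.1 p.1.2 p.2‖ ^ 2 :=
    (measurable_zoGrad_comp hF.meas hF.diff measurable_fst.fst measurable_fst.snd
      measurable_snd).norm.pow_const 2
  set b : Euc n × Ξ → ℝ := fun p =>
    2 * (n + 4) * (‖stochGrad F p.1 p.2‖ ^ 2 + μ ^ 2 * K ^ 2 * (n + 4) ^ 2) with hb
  have hbm : Measurable b :=
    ((hF.measurable_stochGrad.norm.pow_const 2).add_const _).const_mul _
  have hbi : Integrable (fun ω => b (Y ω, ξ ω)) P :=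
    (h1.add (integrable_const _)).const_mul _
  have hds := fun s => (hF.diff s).differentiable one_ne_zero
  obtain ⟨h3, h4⟩ := integrable_and_integral_le_of_indepFun (W := fun ω => (Y ω, ξ ω))
    (H := fun p w => ‖zoGrad F μ p.1 p.2 w‖ ^ 2) (hY.prodMk hS.meas_sample) hS.meas_dir
    (hind.prodMk_of_prodMk hY hS.meas_sample hS.meas_dir hS.indep) hm
    (fun _ _ => by positivity) hbm hbi
    (fun p => by
      rw [hS.law_dir]
      exact integrable_norm_gaussDiff_sq (hds p.2) (hF.lip p.2) hμ p.1)
    (fun p => by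
      rw [hS.law_dir]
      have h := integral_norm_gaussDiff_sq_le (hds p.2) (hF.lip p.2) hμ p.1
      rw [finrank_euclideanSpace_fin] at h
      exact h)
  refine ⟨h3, h4.trans ?_⟩
  simp only [hb]
  rw [integral_const_mul, integral_add h1 (integrable_const _), integral_const,
    probReal_univ, one_smul]
  gcongr

/-- Centring does not increase the second moment: the noise is orthogonal to its conditional mean,
whose squared norm is dropped. -/
theorem UnbiasedSample.integral_norm_zoNoise_sq_le (hS : UnbiasedSample P F f ξ v)
    (hF : SmoothOracle F K) (hf : Differentiable ℝ f) (hfK : LipschitzWith K (gradient f))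
    (hμ : 0 < μ) (hY : Measurable Y)
    (hind : IndepFun Y (fun ω => (ξ ω, v ω)) P) (hκ : ∀ᵐ ω ∂P, ‖gradient f (Y ω)‖ ≤ κ)
    (hvi : Integrable (fun ω => ‖stochGrad F (Y ω) (ξ ω) - gradient f (Y ω)‖ ^ 2) P)
    (hvar : ∫ ω, ‖stochGrad F (Y ω) (ξ ω) - gradient f (Y ω)‖ ^ 2 ∂P ≤ σ ^ 2) :
    MemLp (fun ω => zoNoise F f μ (Y ω) (ξ ω) (v ω)) 2 P ∧
      ∫ ω, ‖zoNoise F f μ (Y ω) (ξ ω) (v ω)‖ ^ 2 ∂P ≤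
        2 * (n + 4) * (κ ^ 2 + σ ^ 2 + μ ^ 2 * K ^ 2 * (n + 4) ^ 2) := by
  obtain ⟨h1, h2⟩ := hS.integral_norm_zoGrad_sq_le hF hfK hμ hY hind hκ hvi hvar
  have ha : MemLp (fun ω => gaussSmoothGrad f μ (Y ω)) 2 P :=
    memLp_gaussSmoothGrad_of_ae_le hY hfK hκ
  have hz : MemLp (fun ω => zoGrad F μ (Y ω) (ξ ω) (v ω)) 2 P :=
    (memLp_two_iff_integrable_sq_norm (measurable_zoGrad_comp hF.meas hF.diff hY hS.meas_sample
      hS.meas_dir).aestronglyMeasurable).2 h1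
  have hN : MemLp (fun ω => zoNoise F f μ (Y ω) (ξ ω) (v ω)) 2 P := hz.sub ha
  refine ⟨hN, le_trans ?_ h2⟩
  have hcross := ha.integrable_real_inner hN
  have h0 := hS.integral_inner_zoNoise (y := fun x => x) (φ := gaussSmoothGrad f μ) hF hf hfK hμ hY
    measurable_id (lipschitzWith_gaussSmoothGrad hfK).continuous.measurable hind hcross
  have hNi : Integrable (fun ω => ‖zoNoise F f μ (Y ω) (ξ ω) (v ω)‖ ^ 2) P := by
    simpa using hN.integrable_norm_pow two_ne_zero
  have hle : ∀ ω, ‖zoNoise F f μ (Y ω) (ξ ω) (v ω)‖ ^ 2 +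
      2 * inner ℝ (gaussSmoothGrad f μ (Y ω)) (zoNoise F f μ (Y ω) (ξ ω) (v ω)) ≤
        ‖zoGrad F μ (Y ω) (ξ ω) (v ω)‖ ^ 2 := fun ω => by
    have h3 : zoGrad F μ (Y ω) (ξ ω) (v ω) =
        gaussSmoothGrad f μ (Y ω) + zoNoise F f μ (Y ω) (ξ ω) (v ω) := by
      rw [zoNoise, add_sub_cancel]
    rw [h3, norm_add_sq_real]
    nlinarith [sq_nonneg ‖gaussSmoothGrad f μ (Y ω)‖]
  have := integral_mono (hNi.add (hcross.const_mul 2)) h1 hle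
  simp only [Pi.add_apply] at this
  rwa [integral_add hNi (hcross.const_mul 2), integral_const_mul, h0, mul_zero, add_zero] at this

end State

end StochNCO

/-! ### Mini-batches: orthogonal noises and the factor `1 / m`. -/

namespace StochNCO

variable {n : ℕ} {Ξ Ω : Type*} [MeasurableSpace Ξ] [MeasurableSpace Ω]
  {P : Measure Ω} [IsProbabilityMeasure P] {F : Euc n → Ξ → ℝ} {f : Euc n → ℝ} {K : ℝ≥0}
  {μ : ℝ} {ξ : ℕ → Ω → Ξ} {v : ℕ → Ω → Euc n} {m : ℕ} {Y : Ω → Euc n} {κ σ : ℝ}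

omit [MeasurableSpace Ξ] in
theorem batchGrad_sub (hm : 0 < m) (x : Euc n) (s : ℕ → Ξ) (w : ℕ → Euc n) :
    batchGrad F μ m x s w - gaussSmoothGrad f μ x =
      (1 / (m : ℝ)) • ∑ i ∈ Finset.range m, zoNoise F f μ x (s i) (w i) := by
  have hm' : (m : ℝ) ≠ 0 := by positivity
  simp only [batchGrad, zoNoise, Finset.sum_sub_distrib, Finset.sum_const, Finset.card_range,
    smul_sub]
  rw [← Nat.cast_smul_eq_nsmul ℝ, smul_smul, one_div, inv_mul_cancel₀ hm', one_smul]

/-- The state `Y` before a batch, and the samples of the batch. -/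
structure BatchSetup (P : Measure Ω) (F : Euc n → Ξ → ℝ) (f : Euc n → ℝ) (ξ : ℕ → Ω → Ξ)
    (v : ℕ → Ω → Euc n) (m : ℕ) (Y : Ω → Euc n) (κ σ : ℝ) : Prop where
  pos : 0 < m
  meas : Measurable Y
  sample : ∀ i < m, UnbiasedSample P F f (ξ i) (v i)
  indep : ∀ i < m, IndepFun Y (fun ω => (ξ i ω, v i ω)) P
  indep_pair : ∀ i < m, ∀ j < m, i ≠ j →
    IndepFun (fun ω => (Y ω, ξ i ω, v i ω)) (fun ω => (ξ j ω, v j ω)) P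
  bound : ∀ᵐ ω ∂P, ‖gradient f (Y ω)‖ ≤ κ
  var_int : ∀ i < m, Integrable (fun ω => ‖stochGrad F (Y ω) (ξ i ω) - gradient f (Y ω)‖ ^ 2) P
  var_le : ∀ i < m, ∫ ω, ‖stochGrad F (Y ω) (ξ i ω) - gradient f (Y ω)‖ ^ 2 ∂P ≤ σ ^ 2

namespace BatchSetup

theorem zoNoise_bound (hB : BatchSetup P F f ξ v m Y κ σ) (hF : SmoothOracle F K)
    (hf : Differentiable ℝ f) (hfK : LipschitzWith K (gradient f)) (hμ : 0 < μ) {i : ℕ}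
    (hi : i < m) :
    MemLp (fun ω => zoNoise F f μ (Y ω) (ξ i ω) (v i ω)) 2 P ∧
      ∫ ω, ‖zoNoise F f μ (Y ω) (ξ i ω) (v i ω)‖ ^ 2 ∂P ≤
        2 * (n + 4) * (κ ^ 2 + σ ^ 2 + μ ^ 2 * K ^ 2 * (n + 4) ^ 2) :=
  (hB.sample i hi).integral_norm_zoNoise_sq_le hF hf hfK hμ hB.meas (hB.indep i hi) hB.bound
    (hB.var_int i hi) (hB.var_le i hi)

/-- The two noises share the state, so they need not be independent; but noise `j` is centred once
the state and sample `i` are frozen. -/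
theorem integral_inner_zoNoise_zoNoise (hB : BatchSetup P F f ξ v m Y κ σ)
    (hF : SmoothOracle F K) (hf : Differentiable ℝ f) (hfK : LipschitzWith K (gradient f))
    (hμ : 0 < μ) {i j : ℕ} (hi : i < m) (hj : j < m) (hij : i ≠ j) :
    ∫ ω, (inner ℝ (zoNoise F f μ (Y ω) (ξ i ω) (v i ω))
      (zoNoise F f μ (Y ω) (ξ j ω) (v j ω)) : ℝ) ∂P = 0 :=
  (hB.sample j hj).integral_inner_zoNoise (W := fun ω => (Y ω, ξ i ω, v i ω)) (y := Prod.fst)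
    (φ := fun w => zoNoise F f μ w.1 w.2.1 w.2.2) hF hf hfK hμ
    (hB.meas.prodMk ((hB.sample i hi).meas_sample.prodMk (hB.sample i hi).meas_dir))
    measurable_fst
    (hF.measurable_zoNoise hfK measurable_fst measurable_snd.fst measurable_snd.snd)
    (hB.indep_pair i hi j hj hij)
    ((hB.zoNoise_bound hF hf hfK hμ hi).1.integrable_real_inner
      (hB.zoNoise_bound hF hf hfK hμ hj).1)

theorem memLp_batchGrad_sub (hB : BatchSetup P F f ξ v m Y κ σ) (hF : SmoothOracle F K)
    (hf : Differentiable ℝ f) (hfK : LipschitzWith K (gradient f)) (hμ : 0 < μ) :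
    MemLp (fun ω => batchGrad F μ m (Y ω) (fun i => ξ i ω) (fun i => v i ω) -
      gaussSmoothGrad f μ (Y ω)) 2 P := by
  simp_rw [batchGrad_sub hB.pos]
  exact (memLp_finsetSum _ fun i hi =>
    (hB.zoNoise_bound hF hf hfK hμ (Finset.mem_range.1 hi)).1).const_smul (1 / (m : ℝ))

theorem memLp_gaussSmoothGrad (hB : BatchSetup P F f ξ v m Y κ σ)
    (hfK : LipschitzWith K (gradient f)) :
    MemLp (fun ω => gaussSmoothGrad f μ (Y ω)) 2 P :=
  memLp_gaussSmoothGrad_of_ae_le hB.meas hfK hB.bound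

theorem memLp_batchGrad (hB : BatchSetup P F f ξ v m Y κ σ) (hF : SmoothOracle F K)
    (hf : Differentiable ℝ f) (hfK : LipschitzWith K (gradient f)) (hμ : 0 < μ) :
    MemLp (fun ω => batchGrad F μ m (Y ω) (fun i => ξ i ω) (fun i => v i ω)) 2 P := by
  refine ((hB.memLp_batchGrad_sub hF hf hfK hμ).add
    (hB.memLp_gaussSmoothGrad (μ := μ) hfK)).ae_eq (Filter.Eventually.of_forall fun ω => ?_)
  simp only [Pi.add_apply, sub_add_cancel]

/-- Expand the square: only the `m` diagonal terms survive, and the prefactor is `1 / m²`. -/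
theorem integral_norm_batchGrad_sub_sq_le (hB : BatchSetup P F f ξ v m Y κ σ)
    (hF : SmoothOracle F K) (hf : Differentiable ℝ f) (hfK : LipschitzWith K (gradient f))
    (hμ : 0 < μ) :
    ∫ ω, ‖batchGrad F μ m (Y ω) (fun i => ξ i ω) (fun i => v i ω) -
      gaussSmoothGrad f μ (Y ω)‖ ^ 2 ∂P ≤
        2 * (n + 4) * (κ ^ 2 + σ ^ 2 + μ ^ 2 * K ^ 2 * (n + 4) ^ 2) / m := by
  have hm' : (0 : ℝ) < m := Nat.cast_pos.2 hB.pos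
  have hN := fun i (hi : i ∈ Finset.range m) =>
    hB.zoNoise_bound hF hf hfK hμ (Finset.mem_range.1 hi)
  set s2 := 2 * (n + 4) * (κ ^ 2 + σ ^ 2 + μ ^ 2 * K ^ 2 * (n + 4) ^ 2)
  have hexp : ∀ ω, ‖batchGrad F μ m (Y ω) (fun i => ξ i ω) (fun i => v i ω) -
      gaussSmoothGrad f μ (Y ω)‖ ^ 2 = (1 / (m : ℝ)) ^ 2 * ∑ i ∈ Finset.range m,
        ∑ j ∈ Finset.range m, inner ℝ (zoNoise F f μ (Y ω) (ξ i ω) (v i ω))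
          (zoNoise F f μ (Y ω) (ξ j ω) (v j ω)) := fun ω => by
    rw [batchGrad_sub hB.pos, norm_smul, mul_pow, Real.norm_of_nonneg (by positivity),
      ← real_inner_self_eq_norm_sq, sum_inner]
    simp_rw [inner_sum]
  simp_rw [hexp]
  have hii := fun i hi j hj => (hN i hi).1.integrable_real_inner (hN j hj).1
  rw [integral_const_mul,
    integral_finsetSum _ fun i hi => integrable_finsetSum _ fun j hj => hii i hi j hj]
  have hrow : ∀ i ∈ Finset.range m, ∫ ω, ∑ j ∈ Finset.range m,
      (inner ℝ (zoNoise F f μ (Y ω) (ξ i ω) (v i ω))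
        (zoNoise F f μ (Y ω) (ξ j ω) (v j ω)) : ℝ) ∂P ≤ s2 := by
    intro i hi
    rw [integral_finsetSum _ fun j hj => hii i hi j hj, Finset.sum_eq_single_of_mem i hi
      fun j hj hji => hB.integral_inner_zoNoise_zoNoise hF hf hfK hμ (Finset.mem_range.1 hi)
        (Finset.mem_range.1 hj) hji.symm]
    simp_rw [real_inner_self_eq_norm_sq]
    exact (hN i hi).2
  calc _ ≤ (1 / (m : ℝ)) ^ 2 * (m * s2) := by
        gcongr
        exact (Finset.sum_le_sum hrow).trans_eq (by simp)
    _ = s2 / m := by field_simp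

theorem integral_inner_batchGrad_sub (hB : BatchSetup P F f ξ v m Y κ σ)
    (hF : SmoothOracle F K) (hf : Differentiable ℝ f) (hfK : LipschitzWith K (gradient f))
    (hμ : 0 < μ) {φ : Euc n → Euc n} (hφ : Measurable φ) (hφi : MemLp (fun ω => φ (Y ω)) 2 P) :
    ∫ ω, (inner ℝ (batchGrad F μ m (Y ω) (fun i => ξ i ω) (fun i => v i ω) -
      gaussSmoothGrad f μ (Y ω)) (φ (Y ω)) : ℝ) ∂P = 0 := by
  have hexp : ∀ ω, (inner ℝ (batchGrad F μ m (Y ω) (fun i => ξ i ω) (fun i => v i ω) -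
      gaussSmoothGrad f μ (Y ω)) (φ (Y ω)) : ℝ) = (1 / (m : ℝ)) * ∑ i ∈ Finset.range m,
        inner ℝ (φ (Y ω)) (zoNoise F f μ (Y ω) (ξ i ω) (v i ω)) := fun ω => by
    rw [batchGrad_sub hB.pos, real_inner_comm, inner_smul_right, inner_sum]
  have hi : ∀ i ∈ Finset.range m, Integrable (fun ω =>
      (inner ℝ (φ (Y ω)) (zoNoise F f μ (Y ω) (ξ i ω) (v i ω)) : ℝ)) P := fun i hi =>
    hφi.integrable_real_inner (hB.zoNoise_bound hF hf hfK hμ (Finset.mem_range.1 hi)).1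
  have h0 : ∀ i ∈ Finset.range m,
      ∫ ω, (inner ℝ (φ (Y ω)) (zoNoise F f μ (Y ω) (ξ i ω) (v i ω)) : ℝ) ∂P = 0 := by
    intro i hi'
    have him := Finset.mem_range.1 hi'
    have h1 := (hB.sample i him).integral_inner_zoNoise (W := Y) (y := fun x => x) (φ := φ)
      hF hf hfK hμ hB.meas measurable_id hφ (hB.indep i him)
    exact h1 (hi i hi')
  simp_rw [hexp]
  rw [integral_const_mul, integral_finsetSum _ hi, Finset.sum_eq_zero h0, mul_zero]

end BatchSetup

section Step

variable {q : ℕ} {h : Euc q → ℝ} {c : Euc n → Euc q} {γ : ℝ} {Lh LJ : ℝ≥0}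

theorem memLp_fderiv_comp (hc : ContDiff ℝ 1 c) (hcLip : LipschitzWith LJ (fderiv ℝ c))
    (hY : MemLp Y 2 P) : MemLp (fun ω => fderiv ℝ c (Y ω)) 2 P := by
  have hJ : Continuous (fderiv ℝ c) := hc.continuous_fderiv one_ne_zero
  have h1 : MemLp (fun ω => ‖fderiv ℝ c 0‖ + LJ * ‖Y ω‖) 2 P :=
    (memLp_const (μ := P) (p := 2) ‖fderiv ℝ c 0‖).add (hY.norm.const_mul (LJ : ℝ))
  refine h1.mono' (hJ.comp_aestronglyMeasurable hY.1) (Filter.Eventually.of_forall fun ω => ?_)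
  have h2 := hcLip.norm_sub_le (Y ω) 0
  rw [sub_zero] at h2
  have := norm_le_norm_add_norm_sub (fderiv ℝ c 0) (fderiv ℝ c (Y ω))
  rw [norm_sub_rev] at this
  linarith

theorem memLp_genGrad (hc : ContDiff ℝ 1 c) (hcLip : LipschitzWith LJ (fderiv ℝ c))
    (hconv : ConvexOn ℝ univ h) (hhLip : LipschitzWith Lh h) (hγ : 0 < γ) (hY : MemLp Y 2 P)
    {g : Ω → Euc n} (hg : MemLp g 2 P) : MemLp (fun ω => genGrad h c γ (Y ω) (g ω)) 2 P :=
  (hg.norm.add ((memLp_fderiv_comp hc hcLip hY).norm.const_mul (Lh : ℝ))).mono'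
    ((continuous_genGrad hc hconv hhLip hγ).comp_aestronglyMeasurable (hY.1.prodMk hg.1))
    (Filter.Eventually.of_forall fun _ => norm_genGrad_le hconv hhLip hγ _ _)

/-- The expected effect of the noise of a batch on the decrease of the objective. -/
theorem BatchSetup.integral_noise_le (hB : BatchSetup P F f ξ v m Y κ σ)
    (hF : SmoothOracle F K) (hf : Differentiable ℝ f) (hfK : LipschitzWith K (gradient f))
    (hμ : 0 < μ) (hc : ContDiff ℝ 1 c) (hcLip : LipschitzWith LJ (fderiv ℝ c))
    (hconv : ConvexOn ℝ univ h) (hhLip : LipschitzWith Lh h) (hγ : 0 < γ) (hY : MemLp Y 2 P) :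
    Integrable (fun ω =>
      inner ℝ (batchGrad F μ m (Y ω) (fun i => ξ i ω) (fun i => v i ω) -
          gaussSmoothGrad f μ (Y ω)) (genGrad h c γ (Y ω) (gaussSmoothGrad f μ (Y ω))) +
        ‖batchGrad F μ m (Y ω) (fun i => ξ i ω) (fun i => v i ω) -
          gaussSmoothGrad f μ (Y ω)‖ ^ 2) P ∧
    ∫ ω, (inner ℝ (batchGrad F μ m (Y ω) (fun i => ξ i ω) (fun i => v i ω) -
          gaussSmoothGrad f μ (Y ω)) (genGrad h c γ (Y ω) (gaussSmoothGrad f μ (Y ω))) +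
        ‖batchGrad F μ m (Y ω) (fun i => ξ i ω) (fun i => v i ω) -
          gaussSmoothGrad f μ (Y ω)‖ ^ 2) ∂P ≤
      2 * (n + 4) * (κ ^ 2 + σ ^ 2 + μ ^ 2 * K ^ 2 * (n + 4) ^ 2) / m := by
  have hd := hB.memLp_batchGrad_sub hF hf hfK hμ
  have hp := memLp_genGrad hc hcLip hconv hhLip hγ hY (hB.memLp_gaussSmoothGrad (μ := μ) hfK)
  have hφ : Measurable fun x => genGrad h c γ x (gaussSmoothGrad f μ x) :=
    ((continuous_genGrad hc hconv hhLip hγ).comp (continuous_id.prodMk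
      (lipschitzWith_gaussSmoothGrad hfK).continuous)).measurable
  have h1 := hd.integrable_real_inner hp
  have h2 : Integrable (fun ω => ‖batchGrad F μ m (Y ω) (fun i => ξ i ω) (fun i => v i ω) -
      gaussSmoothGrad f μ (Y ω)‖ ^ 2) P := by
    simpa using hd.integrable_norm_pow two_ne_zero
  refine ⟨h1.add h2, ?_⟩
  rw [integral_add h1 h2, hB.integral_inner_batchGrad_sub hF hf hfK hμ hφ hp, zero_add]
  exact hB.integral_norm_batchGrad_sub_sq_le hF hf hfK hμ

end Step

end StochNCO

/-! ### Averaging over an independent random index. -/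

/-- The probabilities sum to one, so `R` lies in `s` almost surely and `A (R ω) ω` is a finite sum
of indicators of `R = k` times `A k`; each product factors by independence. -/
theorem integral_random_index {Ω : Type*} [MeasurableSpace Ω] {P : Measure Ω}
    [IsProbabilityMeasure P] {R : Ω → ℕ} {A : ℕ → Ω → ℝ} (s : Finset ℕ) (hR : Measurable R)
    (hs : ∑ k ∈ s, P.real {ω | R ω = k} = 1) (hA : ∀ k ∈ s, Integrable (A k) P)
    (hind : ∀ k ∈ s, IndepFun R (A k) P) :
    Integrable (fun ω => A (R ω) ω) P ∧
      ∫ ω, A (R ω) ω ∂P = ∑ k ∈ s, P.real {ω | R ω = k} * ∫ ω, A k ω ∂P := by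
  have hms : ∀ k, MeasurableSet {ω | R ω = k} := fun k => hR (measurableSet_singleton k)
  have hsupp : ∀ᵐ ω ∂P, R ω ∈ s := by
    have h1 : P.real (R ⁻¹' s) = 1 := by
      rw [← hs, ← measureReal_biUnion_finset (fun i _ j _ hij => by
        rw [Function.onFun, Set.disjoint_left]
        rintro ω rfl h2
        exact hij h2) (fun k _ => hms k)]
      congr 1
      ext ω
      simp
    have h2 : P (R ⁻¹' s) = 1 := by
      rwa [measureReal_def, ENNReal.toReal_eq_one_iff] at h1
    exact (mem_ae_iff_prob_eq_one (hR (Finset.measurableSet s))).2 h2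
  have hind' : ∀ k ∈ s, IndepFun (fun ω => if R ω = k then (1 : ℝ) else 0) (A k) P := fun k hk =>
    (hind k hk).comp (φ := fun r : ℕ => if r = k then (1 : ℝ) else 0) (measurable_of_countable _)
      measurable_id
  have hone : ∀ k, Integrable (fun ω => if R ω = k then (1 : ℝ) else 0) P := fun k =>
    ((integrable_const (1 : ℝ)).indicator (hms k)).congr (Filter.Eventually.of_forall fun ω => by
      simp [Set.indicator_apply])
  have hint : ∀ k ∈ s, Integrable (fun ω => (if R ω = k then (1 : ℝ) else 0) * A k ω) P :=
    fun k hk => (hind' k hk).integrable_mul (hone k) (hA k hk)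
  have hae : (fun ω => A (R ω) ω) =ᵐ[P]
      fun ω => ∑ k ∈ s, (if R ω = k then (1 : ℝ) else 0) * A k ω := by
    filter_upwards [hsupp] with ω hω
    simp [hω]
  refine ⟨(integrable_finsetSum s hint).congr hae.symm, ?_⟩
  rw [integral_congr_ae hae, integral_finsetSum s hint]
  refine Finset.sum_congr rfl fun k hk => ?_
  rw [(hind' k hk).integral_fun_mul_eq_mul_integral (hone k).1 (hA k hk).1]
  congr 1
  have : (fun ω => if R ω = k then (1 : ℝ) else 0) = {ω | R ω = k}.indicator 1 := by
    ext ω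
    simp [Set.indicator_apply]
  rw [this, integral_indicator_one (hms k)]

/-! ### Sample σ-algebras and adaptedness of the iterates. -/

namespace StochNCO

section Filtration

variable {n N : ℕ} {m : ℕ → ℕ} {Ξ Ω : Type*} [MeasurableSpace Ξ]
  {ξ : ℕ → ℕ → Ω → Ξ} {v : ℕ → ℕ → Ω → Euc n}

/-- The σ-algebra generated by the samples with index in `S`. -/
@[reducible]
def sampleSigma (ξ : ℕ → ℕ → Ω → Ξ) (v : ℕ → ℕ → Ω → Euc n) (S : Set (SampleIdx N m)) :
    MeasurableSpace Ω :=
  ⨆ j ∈ S, MeasurableSpace.comap (fun ω => (ξ j.1 j.2 ω, v j.1 j.2 ω)) inferInstance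

theorem sampleSigma_mono {S T : Set (SampleIdx N m)} (h : S ⊆ T) :
    sampleSigma ξ v S ≤ sampleSigma ξ v T :=
  biSup_mono h

theorem measurable_sample {S : Set (SampleIdx N m)} {j : SampleIdx N m} (hj : j ∈ S) :
    Measurable[sampleSigma ξ v S] fun ω => (ξ j.1 j.2 ω, v j.1 j.2 ω) :=
  measurable_iff_comap_le.2 (le_biSup (fun j : SampleIdx N m =>
    MeasurableSpace.comap (fun ω => (ξ j.1 j.2 ω, v j.1 j.2 ω)) inferInstance) hj)

theorem measurable_sample_of_mem {S : Set (SampleIdx N m)} {k i : ℕ} (hk : k ∈ Finset.Icc 1 N)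
    (hi : i < m k) (h : (⟨⟨k, hk⟩, ⟨i, hi⟩⟩ : SampleIdx N m) ∈ S) :
    Measurable[sampleSigma ξ v S] fun ω => (ξ k i ω, v k i ω) :=
  measurable_sample h

theorem sampleSigma_le [mΩ : MeasurableSpace Ω]
    (hξ : ∀ k ∈ Finset.Icc 1 N, ∀ i < m k, Measurable (ξ k i))
    (hv : ∀ k ∈ Finset.Icc 1 N, ∀ i < m k, Measurable (v k i)) (S : Set (SampleIdx N m)) :
    sampleSigma ξ v S ≤ mΩ :=
  iSup₂_le fun j _ => measurable_iff_comap_le.1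
    ((hξ j.1 j.1.2 j.2 j.2.2).prodMk (hv j.1 j.1.2 j.2 j.2.2))

/-- Disjoint blocks of a mutually independent family are independent. Every independence between a
state and its batch is obtained from this. -/
theorem indepFun_of_measurable_sampleSigma [mΩ : MeasurableSpace Ω] {P : Measure Ω}
    (hξ : ∀ k ∈ Finset.Icc 1 N, ∀ i < m k, Measurable (ξ k i))
    (hv : ∀ k ∈ Finset.Icc 1 N, ∀ i < m k, Measurable (v k i))
    (hind : iIndepFun
      (fun (j : SampleIdx N m) (ω : Ω) => (ξ j.1 j.2 ω, v j.1 j.2 ω)) P)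
    {S T : Set (SampleIdx N m)} (hST : Disjoint S T) {A B : Type*} [MeasurableSpace A]
    [MeasurableSpace B] {X : Ω → A} {W : Ω → B} (hX : Measurable[sampleSigma ξ v S] X)
    (hW : Measurable[sampleSigma ξ v T] W) : IndepFun X W P := by
  rw [IndepFun_iff_Indep]
  have hle : ∀ j : SampleIdx N m,
      MeasurableSpace.comap (fun ω => (ξ j.1 j.2 ω, v j.1 j.2 ω)) inferInstance ≤ mΩ := fun j =>
    measurable_iff_comap_le.1 ((hξ j.1 j.1.2 j.2 j.2.2).prodMk (hv j.1 j.1.2 j.2 j.2.2))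
  have hi : Indep (sampleSigma ξ v S) (sampleSigma ξ v T) P :=
    indep_iSup_of_disjoint hle ((iIndepFun_iff_iIndep _ _ P).1 hind) hST
  exact indep_of_indep_of_le_left (indep_of_indep_of_le_right hi
    (measurable_iff_comap_le.1 hW)) (measurable_iff_comap_le.1 hX)

/-- The indices of the samples used before iteration `k`. -/
def past (N : ℕ) (m : ℕ → ℕ) (k : ℕ) : Set (SampleIdx N m) := {j | (j.1 : ℕ) < k}

variable {q : ℕ} {h : Euc q → ℝ} {c : Euc n → Euc q} {F : Euc n → Ξ → ℝ} {μ : ℝ} {γ : ℕ → ℝ}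
  {x₁ : Euc n} {Lh K : ℝ≥0}

omit [MeasurableSpace Ξ] in
theorem iterate_succ {k : ℕ} (hk : 1 ≤ k) (s : ℕ → ℕ → Ξ) (w : ℕ → ℕ → Euc n) :
    iterate h c F μ γ m x₁ s w (k + 1) =
      xPlus h c (γ k) (iterate h c F μ γ m x₁ s w k)
        (batchGrad F μ (m k) (iterate h c F μ γ m x₁ s w k) (s k) (w k)) := by
  obtain ⟨k, rfl⟩ := Nat.exists_eq_add_of_le' hk
  rfl

omit [MeasurableSpace Ξ] in
theorem measurable_xPlus_comp {_ : MeasurableSpace Ω} (hc : ContDiff ℝ 1 c)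
    (hconv : ConvexOn ℝ univ h) (hhLip : LipschitzWith Lh h) {a : ℝ} (ha : 0 < a)
    {Y g : Ω → Euc n} (hY : Measurable Y) (hg : Measurable g) :
    Measurable fun ω => xPlus h c a (Y ω) (g ω) := by
  have := (continuous_xPlus hc hconv hhLip ha).measurable.comp (hY.prodMk hg)
  exact this

omit [MeasurableSpace Ξ] in
theorem measurable_genGrad_comp {_ : MeasurableSpace Ω} (hc : ContDiff ℝ 1 c)
    (hconv : ConvexOn ℝ univ h) (hhLip : LipschitzWith Lh h) {a : ℝ} (ha : 0 < a)
    {Y g : Ω → Euc n} (hY : Measurable Y) (hg : Measurable g) :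
    Measurable fun ω => genGrad h c a (Y ω) (g ω) := by
  have := (continuous_genGrad hc hconv hhLip ha).measurable.comp (hY.prodMk hg)
  exact this

/-- The `k`-th iterate uses only batches with index below `k`. The range reaches `N + 1` because the
iterate produced by the last step is included. -/
theorem measurable_iterate (hF : SmoothOracle F K) (hc : ContDiff ℝ 1 c)
    (hconv : ConvexOn ℝ univ h) (hhLip : LipschitzWith Lh h)
    (hγ : ∀ k ∈ Finset.Icc 1 N, 0 < γ k) {k : ℕ} (hk : 1 ≤ k) (hkN : k ≤ N + 1) :
    Measurable[sampleSigma ξ v (past N m k)] fun ω =>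
      iterate h c F μ γ m x₁ (fun k i => ξ k i ω) (fun k i => v k i ω) k := by
  induction k, hk using Nat.le_induction with
  | base => exact measurable_const
  | succ k hk ih =>
    have hkN' : k ∈ Finset.Icc 1 N := Finset.mem_Icc.2 ⟨hk, by omega⟩
    have hmono : sampleSigma ξ v (past N m k) ≤ sampleSigma ξ v (past N m (k + 1)) :=
      sampleSigma_mono fun j hj => Nat.lt_succ_of_lt hj
    have hX := (ih (by omega)).mono hmono le_rfl
    have hZ : ∀ i < m k, Measurable[sampleSigma ξ v (past N m (k + 1))]
        fun ω => (ξ k i ω, v k i ω) := fun i hi =>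
      measurable_sample_of_mem hkN' hi (Nat.lt_succ_self k)
    simp_rw [iterate_succ hk]
    exact measurable_xPlus_comp hc hconv hhLip (hγ k hkN') hX
      (measurable_batchGrad hF.meas hF.diff hX (fun i hi => measurable_fst.comp (hZ i hi))
        (fun i hi => measurable_snd.comp (hZ i hi)))

end Filtration

end StochNCO

/-! ### Telescoped descent along a sample path. -/

namespace StochNCO

section Descent

variable {n q : ℕ} {Ξ : Type*} {h : Euc q → ℝ} {c : Euc n → Euc q} {F : Euc n → Ξ → ℝ}
  {f : Euc n → ℝ} {μ : ℝ} {γ : ℕ → ℝ} {m : ℕ → ℕ} {x₁ : Euc n} {K LJ Lh : ℝ≥0}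

/-- `descent_step` for the smoothed objective, telescoped; the noise is measured against the
smoothed gradient. -/
theorem sum_norm_stochGenGrad_sq_le (hf : Differentiable ℝ f) (hfK : LipschitzWith K (gradient f))
    (hc : ContDiff ℝ 1 c) (hcLip : LipschitzWith LJ (fderiv ℝ c)) (hconv : ConvexOn ℝ univ h)
    (hhLip : LipschitzWith Lh h) (s : ℕ → ℕ → Ξ) (w : ℕ → ℕ → Euc n) (X : ℕ → Euc n)
    (hX : ∀ k, X k = iterate h c F μ γ m x₁ s w k) (N : ℕ)
    (hγ : ∀ k ∈ Finset.Icc 1 N, 0 < γ k) :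
    ∑ k ∈ Finset.Icc 1 N, (γ k - (K + Lh * LJ) * γ k ^ 2 / 2) *
        ‖stochGenGrad h c F μ γ m x₁ s w k‖ ^ 2 ≤
      (gaussSmooth f μ x₁ + h (c x₁)) - (gaussSmooth f μ (X (N + 1)) + h (c (X (N + 1)))) +
      ∑ k ∈ Finset.Icc 1 N, γ k *
        (inner ℝ (batchGrad F μ (m k) (X k) (s k) (w k) - gaussSmoothGrad f μ (X k))
          (genGrad h c (γ k) (X k) (gaussSmoothGrad f μ (X k))) +
        ‖batchGrad F μ (m k) (X k) (s k) (w k) - gaussSmoothGrad f μ (X k)‖ ^ 2) := by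
  induction N with
  | zero => simp [hX, iterate]
  | succ N ih =>
    rw [Finset.sum_Icc_succ_top (by omega), Finset.sum_Icc_succ_top (by omega)]
    have ih' := ih fun k hk => hγ k (Finset.Icc_subset_Icc_right (Nat.le_succ N) hk)
    have hstep : X (N + 1 + 1) = xPlus h c (γ (N + 1)) (X (N + 1))
        (batchGrad F μ (m (N + 1)) (X (N + 1)) (s (N + 1)) (w (N + 1))) := by
      rw [hX, iterate_succ (by omega), ← hX]
    have hgen : stochGenGrad h c F μ γ m x₁ s w (N + 1) = genGrad h c (γ (N + 1)) (X (N + 1))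
        (batchGrad F μ (m (N + 1)) (X (N + 1)) (s (N + 1)) (w (N + 1))) := by
      rw [stochGenGrad, ← hX]
    have hd := descent_step (φ := gaussSmooth f μ) (x := X (N + 1))
      (g := batchGrad F μ (m (N + 1)) (X (N + 1)) (s (N + 1)) (w (N + 1))) hc hcLip hconv hhLip
      (hγ (N + 1) (by simp)) (gaussSmooth_le hf hfK (X (N + 1))) rfl
    rw [← hstep, ← hgen] at hd
    linarith

/-- Passing from the smoothing back to `f` at `x₁` and at the final iterate costs `μ² K n / 2` each
time. -/
theorem sum_norm_stochGenGrad_sq_le_of_le (hf : Differentiable ℝ f)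
    (hfK : LipschitzWith K (gradient f))
    (hc : ContDiff ℝ 1 c) (hcLip : LipschitzWith LJ (fderiv ℝ c)) (hconv : ConvexOn ℝ univ h)
    (hhLip : LipschitzWith Lh h) {Φlow : ℝ} (hΦlow : ∀ x, Φlow ≤ Phi f h c x)
    (s : ℕ → ℕ → Ξ) (w : ℕ → ℕ → Euc n) (X : ℕ → Euc n)
    (hX : ∀ k, X k = iterate h c F μ γ m x₁ s w k) (N : ℕ)
    (hγ : ∀ k ∈ Finset.Icc 1 N, 0 < γ k) :
    ∑ k ∈ Finset.Icc 1 N, (γ k - (K + Lh * LJ) * γ k ^ 2 / 2) *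
        ‖stochGenGrad h c F μ γ m x₁ s w k‖ ^ 2 ≤
      (Phi f h c x₁ - Φlow) + μ ^ 2 * K * n +
      ∑ k ∈ Finset.Icc 1 N, γ k *
        (inner ℝ (batchGrad F μ (m k) (X k) (s k) (w k) - gaussSmoothGrad f μ (X k))
          (genGrad h c (γ k) (X k) (gaussSmoothGrad f μ (X k))) +
        ‖batchGrad F μ (m k) (X k) (s k) (w k) - gaussSmoothGrad f μ (X k)‖ ^ 2) := by
  refine (sum_norm_stochGenGrad_sq_le hf hfK hc hcLip hconv hhLip s w X hX N hγ).trans ?_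
  gcongr
  have h1 := (abs_le.1 (abs_gaussSmooth_sub_le (μ := μ) hf hfK x₁)).2
  have h2 := (abs_le.1 (abs_gaussSmooth_sub_le (μ := μ) hf hfK (X (N + 1)))).1
  have h3 := hΦlow (X (N + 1))
  rw [finrank_euclideanSpace_fin] at h1 h2
  simp only [Phi] at h3 ⊢
  linarith

end Descent

/-! ### Independence along the iterates and the expected descent. -/

section Expectation

variable {n q N : ℕ} {Ξ Ω : Type*} [MeasurableSpace Ξ] [MeasurableSpace Ω] {P : Measure Ω}
  [IsProbabilityMeasure P] {h : Euc q → ℝ} {c : Euc n → Euc q} {F : Euc n → Ξ → ℝ}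
  {f : Euc n → ℝ} {μ : ℝ} {γ : ℕ → ℝ} {m : ℕ → ℕ} {x₁ : Euc n} {K LJ Lh : ℝ≥0}
  {ξ : ℕ → ℕ → Ω → Ξ} {v : ℕ → ℕ → Ω → Euc n} {κ σ : ℝ} {X : ℕ → Ω → Euc n}

omit [IsProbabilityMeasure P] in
theorem batchSetup_iterate (hF : SmoothOracle F K) (hc : ContDiff ℝ 1 c)
    (hconv : ConvexOn ℝ univ h) (hhLip : LipschitzWith Lh h)
    (hγ : ∀ k ∈ Finset.Icc 1 N, 0 < γ k) (hm : ∀ k ∈ Finset.Icc 1 N, 0 < m k)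
    (hS : ∀ k ∈ Finset.Icc 1 N, ∀ i < m k, UnbiasedSample P F f (ξ k i) (v k i))
    (hind : iIndepFun
      (fun (j : SampleIdx N m) (ω : Ω) => (ξ j.1 j.2 ω, v j.1 j.2 ω)) P)
    (hX : ∀ k ω, X k ω =
      iterate h c F μ γ m x₁ (fun k i => ξ k i ω) (fun k i => v k i ω) k)
    (hκ : ∀ k ∈ Finset.Icc 1 N, ∀ᵐ ω ∂P, ‖gradient f (X k ω)‖ ≤ κ)
    (hvar : ∀ k ∈ Finset.Icc 1 N, ∀ i < m k,
      Integrable (fun ω => ‖stochGrad F (X k ω) (ξ k i ω) - gradient f (X k ω)‖ ^ 2) P ∧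
      ∫ ω, ‖stochGrad F (X k ω) (ξ k i ω) - gradient f (X k ω)‖ ^ 2 ∂P ≤ σ ^ 2)
    {k : ℕ} (hk : k ∈ Finset.Icc 1 N) :
    BatchSetup P F f (ξ k) (v k) (m k) (X k) κ σ := by
  have hξ : ∀ k ∈ Finset.Icc 1 N, ∀ i < m k, Measurable (ξ k i) :=
    fun k hk i hi => (hS k hk i hi).meas_sample
  have hv : ∀ k ∈ Finset.Icc 1 N, ∀ i < m k, Measurable (v k i) :=
    fun k hk i hi => (hS k hk i hi).meas_dir
  have hk' := Finset.mem_Icc.1 hk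
  have hXm : Measurable[sampleSigma ξ v (past N m k)] (X k) := by
    rw [funext (hX k)]
    exact measurable_iterate hF hc hconv hhLip hγ hk'.1 (by omega)
  let idx (i : ℕ) (hi : i < m k) : SampleIdx N m := ⟨⟨k, hk⟩, ⟨i, hi⟩⟩
  have hnot : ∀ i hi, idx i hi ∉ past N m k := fun i hi hmem => lt_irrefl k hmem
  refine ⟨hm k hk, hXm.mono (sampleSigma_le hξ hv _) le_rfl, hS k hk, fun i hi => ?_,
    fun i hi j hj hij => ?_, hκ k hk, fun i hi => (hvar k hk i hi).1,
    fun i hi => (hvar k hk i hi).2⟩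
  · exact indepFun_of_measurable_sampleSigma (T := {idx i hi}) hξ hv hind
      (Set.disjoint_singleton_right.2 (hnot i hi)) hXm
      (measurable_sample_of_mem hk hi (Set.mem_singleton _))
  -- The state and sample `i` live on the past enlarged by index `i`, a set that still omits index
  -- `j`.
  · have h1 : Measurable[sampleSigma ξ v (insert (idx i hi) (past N m k))] (X k) :=
      hXm.mono (sampleSigma_mono (Set.subset_insert _ _)) le_rfl
    have h2 : Measurable[sampleSigma ξ v (insert (idx i hi) (past N m k))]
        fun ω => (ξ k i ω, v k i ω) := measurable_sample_of_mem hk hi (Set.mem_insert _ _)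
    refine indepFun_of_measurable_sampleSigma (T := {idx j hj}) hξ hv hind
      (Set.disjoint_singleton_right.2 ?_) (h1.prodMk h2)
      (measurable_sample_of_mem hk hj (Set.mem_singleton _))
    rintro (he | he)
    · simp only [idx, Sigma.mk.injEq, heq_eq_eq, Fin.mk.injEq, true_and] at he
      exact hij he.symm
    · exact hnot j hj he

/-- The derivative of `c` may grow linearly, so square integrability of the generalized gradient
requires that of the iterate; the two are propagated together by induction. -/
theorem memLp_iterate (hF : SmoothOracle F K) (hf : Differentiable ℝ f)
    (hfK : LipschitzWith K (gradient f)) (hμ : 0 < μ) (hc : ContDiff ℝ 1 c)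
    (hcLip : LipschitzWith LJ (fderiv ℝ c)) (hconv : ConvexOn ℝ univ h)
    (hhLip : LipschitzWith Lh h) (hγ : ∀ k ∈ Finset.Icc 1 N, 0 < γ k)
    (hX : ∀ k ω, X k ω =
      iterate h c F μ γ m x₁ (fun k i => ξ k i ω) (fun k i => v k i ω) k)
    (hB : ∀ k ∈ Finset.Icc 1 N, BatchSetup P F f (ξ k) (v k) (m k) (X k) κ σ) {k : ℕ}
    (hk : 1 ≤ k) (hkN : k ≤ N + 1) : MemLp (X k) 2 P := by
  induction k, hk using Nat.le_induction with
  | base =>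
    rw [funext (hX 1)]
    exact memLp_const x₁
  | succ k hk ih =>
    have hkN' : k ∈ Finset.Icc 1 N := Finset.mem_Icc.2 ⟨hk, by omega⟩
    have hXk := ih (by omega)
    have hg := memLp_genGrad hc hcLip hconv hhLip (hγ k hkN') hXk
      ((hB k hkN').memLp_batchGrad hF hf hfK hμ)
    refine (hXk.sub (hg.const_smul (γ k))).ae_eq (Filter.Eventually.of_forall fun ω => ?_)
    simp only [Pi.sub_apply, Pi.smul_apply]
    rw [hX (k + 1), iterate_succ hk, ← hX, sub_eq_add_neg, ← xPlus_sub (hγ k hkN'),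
      add_sub_cancel]

omit [MeasurableSpace Ξ] [MeasurableSpace Ω] in
theorem stochGenGrad_eq
    (hX : ∀ k ω, X k ω =
      iterate h c F μ γ m x₁ (fun k i => ξ k i ω) (fun k i => v k i ω) k) (k : ℕ) (ω : Ω) :
    stochGenGrad h c F μ γ m x₁ (fun k i => ξ k i ω) (fun k i => v k i ω) k =
      genGrad h c (γ k) (X k ω)
        (batchGrad F μ (m k) (X k ω) (fun i => ξ k i ω) (fun i => v k i ω)) := by
  rw [stochGenGrad, ← hX]

omit [IsProbabilityMeasure P] in
/-- The stochastic generalized gradients are functions of the samples, and hence independent of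
everything that is independent of the samples. -/
theorem indepFun_norm_stochGenGrad_sq (hF : SmoothOracle F K) (hc : ContDiff ℝ 1 c)
    (hconv : ConvexOn ℝ univ h) (hhLip : LipschitzWith Lh h)
    (hγ : ∀ k ∈ Finset.Icc 1 N, 0 < γ k) {R : Ω → ℕ}
    (hR : IndepFun R (fun (ω : Ω) (j : SampleIdx N m) => (ξ j.1 j.2 ω, v j.1 j.2 ω)) P)
    {k : ℕ} (hk : k ∈ Finset.Icc 1 N) :
    IndepFun R (fun ω => ‖stochGenGrad h c F μ γ m x₁
      (fun k i => ξ k i ω) (fun k i => v k i ω) k‖ ^ 2) P := by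
  have hk' := Finset.mem_Icc.1 hk
  have hX := (measurable_iterate (ξ := ξ) (v := v) (μ := μ) (m := m) (x₁ := x₁) hF hc hconv hhLip
    hγ hk'.1 (by omega)).mono (sampleSigma_mono (Set.subset_univ _)) le_rfl
  have hZ : ∀ i < m k, Measurable[sampleSigma ξ v (univ : Set (SampleIdx N m))]
      fun ω => (ξ k i ω, v k i ω) := fun i hi =>
    measurable_sample_of_mem hk hi (Set.mem_univ _)
  have hG := measurable_genGrad_comp hc hconv hhLip (hγ k hk) hX
    (measurable_batchGrad (μ := μ) (ξ := ξ k) (v := v k) hF.meas hF.diff hX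
      (fun i hi => measurable_fst.comp (hZ i hi)) (fun i hi => measurable_snd.comp (hZ i hi)))
  have hle : sampleSigma ξ v (univ : Set (SampleIdx N m)) ≤ MeasurableSpace.comap
      (fun (ω : Ω) (j : SampleIdx N m) => (ξ j.1 j.2 ω, v j.1 j.2 ω)) inferInstance :=
    iSup₂_le fun j _ => measurable_iff_comap_le.1 ((measurable_pi_apply j).comp
      (comap_measurable fun (ω : Ω) (j : SampleIdx N m) => (ξ j.1 j.2 ω, v j.1 j.2 ω)))
  rw [IndepFun_iff_Indep] at hR ⊢
  exact indep_of_indep_of_le_right hR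
    ((measurable_iff_comap_le.1 ((measurable_norm.pow_const 2).comp hG)).trans hle)

/-- Integrate the pathwise bound: the endpoint terms are constants, and each noise term contributes
at most `γ_k σ̃² / m_k`. -/
theorem sum_integral_norm_stochGenGrad_sq_le (hF : SmoothOracle F K) (hf : Differentiable ℝ f)
    (hfK : LipschitzWith K (gradient f)) (hμ : 0 < μ) (hc : ContDiff ℝ 1 c)
    (hcLip : LipschitzWith LJ (fderiv ℝ c)) (hconv : ConvexOn ℝ univ h)
    (hhLip : LipschitzWith Lh h) {Φlow : ℝ} (hΦlow : ∀ x, Φlow ≤ Phi f h c x)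
    (hγ : ∀ k ∈ Finset.Icc 1 N, 0 < γ k)
    (hX : ∀ k ω, X k ω =
      iterate h c F μ γ m x₁ (fun k i => ξ k i ω) (fun k i => v k i ω) k)
    (hB : ∀ k ∈ Finset.Icc 1 N, BatchSetup P F f (ξ k) (v k) (m k) (X k) κ σ) :
    (∀ k ∈ Finset.Icc 1 N, Integrable (fun ω => ‖stochGenGrad h c F μ γ m x₁
      (fun k i => ξ k i ω) (fun k i => v k i ω) k‖ ^ 2) P) ∧
    ∑ k ∈ Finset.Icc 1 N, (γ k - (K + Lh * LJ) * γ k ^ 2 / 2) *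
        ∫ ω, ‖stochGenGrad h c F μ γ m x₁
          (fun k i => ξ k i ω) (fun k i => v k i ω) k‖ ^ 2 ∂P ≤
      (Phi f h c x₁ - Φlow) + μ ^ 2 * K * n +
        2 * (n + 4) * (κ ^ 2 + σ ^ 2 + μ ^ 2 * K ^ 2 * (n + 4) ^ 2) *
          ∑ k ∈ Finset.Icc 1 N, γ k / m k := by
  have hXL : ∀ k ∈ Finset.Icc 1 N, MemLp (X k) 2 P := fun k hk =>
    memLp_iterate hF hf hfK hμ hc hcLip hconv hhLip hγ hX hB (Finset.mem_Icc.1 hk).1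
      (Nat.le_succ_of_le (Finset.mem_Icc.1 hk).2)
  have hint : ∀ k ∈ Finset.Icc 1 N, Integrable (fun ω => ‖stochGenGrad h c F μ γ m x₁
      (fun k i => ξ k i ω) (fun k i => v k i ω) k‖ ^ 2) P := fun k hk => by
    have := (memLp_genGrad hc hcLip hconv hhLip (hγ k hk) (hXL k hk)
      ((hB k hk).memLp_batchGrad hF hf hfK hμ)).integrable_norm_pow two_ne_zero
    simp_rw [stochGenGrad_eq hX]
    simpa using this
  refine ⟨hint, ?_⟩
  have hnoise := fun k hk =>
    (hB k hk).integral_noise_le hF hf hfK hμ hc hcLip hconv hhLip (hγ k hk) (hXL k hk)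
  have hni := fun k hk => (hnoise k hk).1.const_mul (γ k)
  have hpt := fun ω => sum_norm_stochGenGrad_sq_le_of_le (F := F) (m := m) (x₁ := x₁) (μ := μ)
    hf hfK hc hcLip hconv hhLip hΦlow
    (fun k i => ξ k i ω) (fun k i => v k i ω) (fun k => X k ω) (fun k => hX k ω) N hγ
  have hmono := integral_mono (μ := P)
    (integrable_finsetSum _ fun k hk => (hint k hk).const_mul _)
    ((integrable_const _).add (integrable_finsetSum _ hni)) hpt
  simp only [Pi.add_apply] at hmono
  rw [integral_finsetSum _ fun k hk => (hint k hk).const_mul _,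
    integral_add (integrable_const _) (integrable_finsetSum _ hni), integral_finsetSum _ hni,
    integral_const, probReal_univ, one_smul] at hmono
  simp_rw [integral_const_mul] at hmono
  refine hmono.trans ?_
  gcongr
  rw [Finset.mul_sum]
  refine Finset.sum_le_sum fun k hk => ?_
  calc _ ≤ γ k * (2 * (n + 4) * (κ ^ 2 + σ ^ 2 + μ ^ 2 * K ^ 2 * (n + 4) ^ 2) / m k) :=
        mul_le_mul_of_nonneg_left (hnoise k hk).2 (hγ k hk).le
    _ = _ := by ring

end Expectation

end StochNCO

/-! ### The main theorem. -/

theorem mainTheorem5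
    {n q : ℕ} {Ξ Ω : Type*} [MeasurableSpace Ξ] [MeasurableSpace Ω]
    (P : Measure Ω) [IsProbabilityMeasure P]
    -- the problem data
    (f : Euc n → ℝ) (h : Euc q → ℝ) (c : Euc n → Euc q)
    (Lg LJ Lh : ℝ≥0) (flow Φlow : ℝ)
    (hf : ContDiff ℝ 1 f) (hc : ContDiff ℝ 1 c)
    (hflow : ∀ x, flow ≤ f x)
    (hfLip : LipschitzWith Lg (gradient f))
    (hcLip : LipschitzWith LJ (fderiv ℝ c))
    (hconv : ConvexOn ℝ univ h) (hhLip : LipschitzWith Lh h)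
    (hΦlow : ∀ x, Φlow ≤ StochNCO.Phi f h c x)
    -- the parameters of the algorithm
    (x₁ : Euc n) (N : ℕ) (hN : 1 ≤ N) (μ : ℝ) (hμ : 0 < μ)
    (m : ℕ → ℕ) (hm : ∀ k ∈ Finset.Icc 1 N, 0 < m k)
    (L : ℝ) (hL : L = Lg + Lh * LJ)
    (γ : ℕ → ℝ) (hγ : ∀ k ∈ Finset.Icc 1 N, 0 < γ k ∧ L * γ k ≤ 2)
    (hγ' : ∃ k ∈ Finset.Icc 1 N, L * γ k < 2)
    -- the samples: the `ξ k i`, the standard Gaussian `v k i` and `R` are mutually independent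
    (ξ : ℕ → ℕ → Ω → Ξ) (v : ℕ → ℕ → Ω → Euc n) (R : Ω → ℕ)
    (hξ : ∀ k ∈ Finset.Icc 1 N, ∀ i < m k, Measurable (ξ k i))
    (hv : ∀ k ∈ Finset.Icc 1 N, ∀ i < m k, Measurable (v k i))
    (hvlaw : ∀ k ∈ Finset.Icc 1 N, ∀ i < m k, P.map (v k i) = stdGaussian (Euc n))
    (hR : Measurable R)
    (hindep : ∀ k ∈ Finset.Icc 1 N, ∀ i < m k, IndepFun (ξ k i) (v k i) P)
    (hiindep : iIndepFun
      (fun (j : StochNCO.SampleIdx N m) (ω : Ω) => (ξ j.1 j.2 ω, v j.1 j.2 ω)) P)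
    (hRindep : IndepFun R
      (fun (ω : Ω) (j : StochNCO.SampleIdx N m) => (ξ j.1 j.2 ω, v j.1 j.2 ω)) P)
    -- the law of `R`
    (hRlaw : ∀ k ∈ Finset.Icc 1 N, P.real {ω | R ω = k} =
      (γ k - L * γ k ^ 2 / 2) / ∑ j ∈ Finset.Icc 1 N, (γ j - L * γ j ^ 2 / 2))
    -- the stochastic zeroth-order oracle
    (F : Euc n → Ξ → ℝ)
    (hFmeas : ∀ x, Measurable (F x))
    (hFdiff : ∀ s, ContDiff ℝ 1 (fun x => F x s))
    (hFLip : ∀ s, LipschitzWith Lg (fun x => StochNCO.stochGrad F x s))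
    (hFint : ∀ k ∈ Finset.Icc 1 N, ∀ i < m k, ∀ x,
      Integrable (fun ω => F x (ξ k i ω)) P ∧ ∫ ω, F x (ξ k i ω) ∂P = f x)
    -- the iterates
    (X : ℕ → Ω → Euc n)
    (hX : ∀ k ω, X k ω =
      StochNCO.iterate h c F μ γ m x₁ (fun k i => ξ k i ω) (fun k i => v k i ω) k)
    -- `G = ∇F` is unbiased, with variance at most `σ²` along the iterates
    (hGmean : ∀ k ∈ Finset.Icc 1 N, ∀ i < m k, ∀ x,
      Integrable (fun ω => StochNCO.stochGrad F x (ξ k i ω)) P ∧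
        ∫ ω, StochNCO.stochGrad F x (ξ k i ω) ∂P = gradient f x)
    (σ : ℝ) (hσ : 0 < σ)
    (hGvar : ∀ k ∈ Finset.Icc 1 N, ∀ i < m k,
      Integrable
        (fun ω => ‖StochNCO.stochGrad F (X k ω) (ξ k i ω) - gradient f (X k ω)‖ ^ 2) P ∧
      ∫ ω, ‖StochNCO.stochGrad F (X k ω) (ξ k i ω) - gradient f (X k ω)‖ ^ 2 ∂P ≤ σ ^ 2)
    -- the gradients of `f` are bounded along the iterates
    (κg : ℝ) (hκg : 0 < κg)
    (hbdd : ∀ k ∈ Finset.Icc 1 N, ∀ᵐ ω ∂P, ‖gradient f (X k ω)‖ ≤ κg)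
    (σt2 : ℝ)
    (hσt2 : σt2 = 2 * (n + 4) * (κg ^ 2 + σ ^ 2 + μ ^ 2 * (Lg : ℝ) ^ 2 * (n + 4) ^ 2)) :
    Integrable (fun ω => ‖StochNCO.stochGenGrad h c F μ γ m x₁
      (fun k i => ξ k i ω) (fun k i => v k i ω) (R ω)‖ ^ 2) P ∧
    ∫ ω, ‖StochNCO.stochGenGrad h c F μ γ m x₁
      (fun k i => ξ k i ω) (fun k i => v k i ω) (R ω)‖ ^ 2 ∂P ≤
      ((StochNCO.Phi f h c x₁ - Φlow) + μ ^ 2 * Lg * n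
          + σt2 * ∑ k ∈ Finset.Icc 1 N, γ k / m k) /
        ∑ k ∈ Finset.Icc 1 N, (γ k - L * γ k ^ 2 / 2) := by
  have hfd : Differentiable ℝ f := hf.differentiable one_ne_zero
  have hF : StochNCO.SmoothOracle F Lg := ⟨hFmeas, hFdiff, hFLip⟩
  have hγ0 : ∀ k ∈ Finset.Icc 1 N, 0 < γ k := fun k hk => (hγ k hk).1
  have hS : ∀ k ∈ Finset.Icc 1 N, ∀ i < m k,
      StochNCO.UnbiasedSample P F f (ξ k i) (v k i) := fun k hk i hi =>
    ⟨hξ k hk i hi, hv k hk i hi, hvlaw k hk i hi, hindep k hk i hi,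
      fun x => (hFint k hk i hi x).1, fun x => (hFint k hk i hi x).2,
      fun x => (hGmean k hk i hi x).1, fun x => (hGmean k hk i hi x).2⟩
  have hB : ∀ k ∈ Finset.Icc 1 N,
      StochNCO.BatchSetup P F f (ξ k) (v k) (m k) (X k) κg σ := fun k hk =>
    StochNCO.batchSetup_iterate hF hc hconv hhLip hγ0 hm hS hiindep hX hbdd hGvar hk
  obtain ⟨hint, hsum⟩ := StochNCO.sum_integral_norm_stochGenGrad_sq_le hF hfd hfLip hμ hc hcLip
    hconv hhLip hΦlow hγ0 hX hB
  rw [← hσt2, ← hL] at hsum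
  have hcoef : ∀ k, γ k - L * γ k ^ 2 / 2 = γ k * (1 - L * γ k / 2) := fun k => by ring
  -- All weights are nonnegative; the one strict stepsize inequality makes their sum positive, so
  -- the law of `R` is properly normalized.
  have hpos : 0 < ∑ k ∈ Finset.Icc 1 N, (γ k - L * γ k ^ 2 / 2) := by
    obtain ⟨k, hk, hlt⟩ := hγ'
    refine Finset.sum_pos' (fun j hj => ?_) ⟨k, hk, ?_⟩
    · rw [hcoef]
      exact mul_nonneg (hγ0 j hj).le (by linarith [(hγ j hj).2])
    · rw [hcoef]
      exact mul_pos (hγ0 k hk) (by linarith)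
  have hone : ∑ k ∈ Finset.Icc 1 N, P.real {ω | R ω = k} = 1 := by
    rw [Finset.sum_congr rfl hRlaw, ← Finset.sum_div, div_self hpos.ne']
  obtain ⟨h1, h2⟩ := integral_random_index (P := P) (R := R)
    (A := fun k ω => ‖StochNCO.stochGenGrad h c F μ γ m x₁
      (fun k i => ξ k i ω) (fun k i => v k i ω) k‖ ^ 2) (Finset.Icc 1 N) hR hone hint
    fun k hk => StochNCO.indepFun_norm_stochGenGrad_sq hF hc hconv hhLip hγ0 hRindep hk
  refine ⟨h1, h2.trans_le ?_⟩
  -- Multiplying by the normalizing sum turns the probabilities of `R` back into the descent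
  -- weights.
  rw [le_div_iff₀ hpos, Finset.sum_mul]
  refine le_trans (le_of_eq (Finset.sum_congr rfl fun k hk => ?_)) hsum
  rw [hRlaw k hk, div_mul_eq_mul_div, div_mul_cancel₀ _ hpos.ne']
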